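/- **Definitions.** A \emph{compact flat Kähler (generalized hyperelliptic) manifold} of complex dimension $n\ge 0$ is the quotient $X=(\mathbb C^n/\Lambda)/F$ of a compact complex torus by a free holomorphic action of a finite group $F$. An \emph{aspherical Kähler group of dimension $n$} is a group isomorphic to the fundamental group of such an $X$. Such a group $\Gamma$ has a unique maximal abelian normal subgroup $L$; it is free abelian of rank $2n$ and the quotient $\Gamma/L$ is finite. One says that $\Gamma$ has \emph{holonomy group} $G$ if $\Gamma/L\cong G$. For a finite group $G$, a \emph{$G$-lattice} is a $\mathbb ZG$-module that is free of finite rank over $\mathbb Z$. A class $\alpha\in H^2(G,A)$ is \emph{special} if its restriction to every nontrivial subgroup of $G$ is nonzero. The \emph{Vasquez number} $n(G)$ is the smallest integer $k\ge 0$ such that for every faithful $G$-lattice $A$ and every special $\alpha\in H^2(G,A)$ there is a $\mathbb Z$-pure $G$-submodule $N\subseteq A$ with $\operatorname{rk}_{\mathbb Z}(A/N)\le k$ and such that the image of $\alpha$ in $H^2(G,A/N)$ is special. **Theorem.** Let $G$ be a finite group. There is an integer $k\ge 0$ with the following property: if $\Gamma$ is an aspherical Kähler group (of any dimension) with holonomy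 group $G$ and maximal abelian normal subgroup $L$, then $L$ contains a subgroup $M$, normal in $\Gamma$, such that $\Gamma/M$ is an aspherical Kähler group of complex dimension at most $k$. Let $n_{\mathbb C}(G)$ be the smallest such $k$. The Vasquez number $n(G)$ also exists, and $$n_{\mathbb C}(G)\le n(G).$$ -/

import Mathlib

open CategoryTheory
open scoped Topology

noncomputable section

/-! ### Compact flat Kähler manifolds and their fundamental groups -/

/-- A self-map `f` of the complex torus `ℂⁿ ⧸ Λ` is holomorphic: locally on `ℂⁿ` it lifts through
the projection `ℂⁿ → ℂⁿ ⧸ Λ` to a holomorphic map. (The complex structure of the torus is the one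
for which the projection is a local biholomorphism.) -/
def IsHolomorphicTorusMap {n : ℕ} (Λ : Submodule ℤ (EuclideanSpace ℂ (Fin n)))
    (f : EuclideanSpace ℂ (Fin n) ⧸ Λ → EuclideanSpace ℂ (Fin n) ⧸ Λ) : Prop :=
  ∀ z : EuclideanSpace ℂ (Fin n), ∃ g : EuclideanSpace ℂ (Fin n) → EuclideanSpace ℂ (Fin n),
    ∀ᶠ w in 𝓝 z, DifferentiableAt ℂ g w ∧ Λ.mkQ (g w) = f (Λ.mkQ w)

/-- The data presenting a compact flat Kähler (generalized hyperelliptic) manifold of complex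
dimension `n`: a compact complex torus `ℂⁿ ⧸ Λ`, with `Λ` a full lattice, and a finite group `F`
acting on it freely by holomorphic maps. The manifold itself is the orbit space, see
`FlatKahlerManifold.Carrier`. -/
structure FlatKahlerManifold (n : ℕ) where
  /-- the lattice of the torus -/
  Λ : Submodule ℤ (EuclideanSpace ℂ (Fin n))
  [discrete : DiscreteTopology Λ]
  [isZLattice : IsZLattice ℝ Λ]
  /-- the finite group acting on the torus -/
  F : Type
  [group : Group F]
  [finite : Finite F]
  [action : MulAction F (EuclideanSpace ℂ (Fin n) ⧸ Λ)]
  holomorphic : ∀ g : F, IsHolomorphicTorusMap Λ (fun x => g • x)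
  free : ∀ (g : F) (x : EuclideanSpace ℂ (Fin n) ⧸ Λ), g • x = x → g = 1

attribute [instance] FlatKahlerManifold.discrete FlatKahlerManifold.isZLattice
  FlatKahlerManifold.group FlatKahlerManifold.finite FlatKahlerManifold.action

/-- The underlying topological space of the manifold: the orbit space of the torus, with the
quotient topology. -/
abbrev FlatKahlerManifold.Carrier {n : ℕ} (X : FlatKahlerManifold n) : Type :=
  MulAction.orbitRel.Quotient X.F (EuclideanSpace ℂ (Fin n) ⧸ X.Λ)

/-- `Γ` is an aspherical Kähler group of (complex) dimension `n`: it is isomorphic to the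
fundamental group of a compact flat Kähler manifold of complex dimension `n`. -/
def IsAsphericalKahlerGroup (Γ : Type*) [Group Γ] (n : ℕ) : Prop :=
  ∃ (X : FlatKahlerManifold n) (x : X.Carrier), Nonempty (Γ ≃* FundamentalGroup X.Carrier x)

/-- `L` is a maximal abelian normal subgroup of `Γ`. -/
def IsMaximalAbelianNormal {Γ : Type*} [Group Γ] (L : Subgroup Γ) : Prop :=
  Maximal (fun A : Subgroup Γ => A.Normal ∧ IsMulCommutative A) L

/-- `k` is an upper bound in the complex Vasquez problem for `G`: whenever `Γ` is an aspherical
Kähler group with holonomy group `G`, that is, with a surjection `p : Γ → G` whose kernel `L` is the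
maximal abelian normal subgroup of `Γ`, there is a subgroup `M` of `L`, normal in `Γ`, such that
`Γ ⧸ M` is an aspherical Kähler group of complex dimension at most `k`. -/
def IsComplexVasquezBound (G : Type*) [Group G] (k : ℕ) : Prop :=
  ∀ (Γ : Type) [Group Γ] (n : ℕ), IsAsphericalKahlerGroup Γ n →
    ∀ p : Γ →* G, Function.Surjective p → IsMaximalAbelianNormal p.ker →
      ∃ (M : Subgroup Γ) (_ : M.Normal), M ≤ p.ker ∧
        ∃ m : ℕ, m ≤ k ∧ IsAsphericalKahlerGroup (Γ ⧸ M) m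

/-! ### The (real) Vasquez number -/

/-- A class `α ∈ H²(G, A)` is special if its restriction to every nontrivial subgroup of `G` is
nonzero. -/
def IsSpecialClass {G : Type} [Group G] {A : Rep.{0} ℤ G} (α : groupCohomology.H2 A) : Prop :=
  ∀ H : Subgroup G, H ≠ ⊥ →
    (groupCohomology.map H.subtype (𝟙 (Rep.res H.subtype A)) 2).hom α ≠ 0

/-- `k` satisfies the conclusion of Vasquez's theorem for `G`: every faithful `G`-lattice `A` with a
special class `α ∈ H²(G, A)` has a `G`-stable `ℤ`-pure submodule `N` such that `A ⧸ N` has rank at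
most `k` and the image of `α` in `H²(G, A ⧸ N)` is special. -/
def IsVasquezBound (G : Type) [Group G] (k : ℕ) : Prop :=
  ∀ (A : Type) [AddCommGroup A] [Module.Free ℤ A] [Module.Finite ℤ A] (ρ : Representation ℤ G A),
    Function.Injective ρ →
    ∀ α : groupCohomology.H2 (Rep.of ρ), IsSpecialClass α →
      ∃ (N : Submodule ℤ A) (hN : ∀ g : G, N ≤ N.comap (ρ g)),
        (∀ (m : ℤ) (a : A), m ≠ 0 → m • a ∈ N → a ∈ N) ∧
        Module.finrank ℤ (A ⧸ N) ≤ k ∧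
        IsSpecialClass
          ((groupCohomology.map (B := Rep.quotient (Rep.of ρ) N hN) (MonoidHom.id G)
            (Rep.mkQ (Rep.of ρ) N hN) 2).hom α)

end

/-!
An aspherical Kähler group `Γ` of dimension `n` is the same as a group with a *complex
crystallographic action*: a free action on `ℂⁿ` by complex affine maps, with a lattice of
translations of finite index. Indeed, a holomorphic map of a torus `ℂⁿ ⧸ Λ` lifts to a continuous
map of `ℂⁿ`, which is affine by Liouville's theorem because its differences are periodic, and the
lifts of the elements of the finite group form the deck transformation group of the universal
covering `ℂⁿ` (`IsAsphericalKahlerGroup.nonempty_action`,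
`ComplexCrystallographicAction.isAsphericalKahlerGroup`). In this picture the maximal abelian normal
subgroup `L` is the group of all translations
(`ComplexCrystallographicAction.eq_ker_lin_of_isMaximalAbelianNormal`), so that `L` is a faithful
`G`-lattice. The class of the extension `Γ` in `H²(G, L)` is special: where it vanishes on a
subgroup of `G`, averaging gives a fixed point in `ℂⁿ` of lifts of its elements
(`ComplexCrystallographicAction.eq_bot_of_coboundary`), and the action is free.

*The number `n(G)` exists.* It suffices to keep the class nonzero on the group generated by each
`c ≠ 1`. There it is described by an invariant element of the lattice modulo norms, and it is
detected by a `c`-invariant integral functional. Dividing by the common kernel of all translates of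
one such functional for each `c` gives a quotient of rank at most `|G|²`
(`isVasquezBound_card_sq`).

*The inequality.* Apply the defining property of `k = n(G)` to `L`: there is a pure submodule `N`
with `L ⧸ N` of rank at most `k` in which the class stays special. This quotient need not carry a
complex structure. However, `V = ℚ ⊗ L` does after extension of scalars to `ℝ`, and `N` contains a
submodule `N'` such that `V ⧸ N'` does too and has dimension at most `2k`
(`HasComplexStructure.exists_le_quotient`). To find it, choose a complement `Q` of `N` in the
semisimple module `V` and map it to `N` by a homomorphism `j` with the smallest possible kernel;
`N'` is a complement of `j(Q)` in `N`. Then `V ⧸ N' ≃ j(Q) × Q`, no simple module occurs both in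
`ker j` and in `N'`, and `V ⧸ N' × ker j ≃ Q × Q` and `V ⧸ N' × N' ≃ V` have complex structures.
Each isotypic part of `V ⧸ N'` inherits a complex structure from one of these two modules.

Therefore a quotient of `L` is a lattice in `ℂᵐ` with `m ≤ k`, invariant under a complex action of
`G`, and its quotient by the image of `N` still has a special class. The induced affine action of a
quotient `Γ ⧸ M` on `ℂᵐ` is free, because a fixed point of an element would split the extension
over the cyclic group which that element generates in `G`
(`ComplexCrystallographicAction.exists_coboundary_of_fixedPoint`). So `Γ ⧸ M` is an aspherical
Kähler group of dimension `m ≤ k`.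
-/

noncomputable section

/-! ### Complex structures on real scalar extensions of semisimple modules -/

/-- If `Hom(S, P) = 0`, then there are no nonzero maps to `P` from the trace of `S` in a module `X`
(the sum of the images of all maps `S → X`). -/
lemma hom_trace_eq_zero {R S X P : Type*} [Ring R]
    [AddCommGroup S] [Module R S] [AddCommGroup X] [Module R X]
    [AddCommGroup P] [Module R P] (hP : ∀ f : S →ₗ[R] P, f = 0)
    (f : (⨆ f : S →ₗ[R] X, LinearMap.range f : Submodule R X) →ₗ[R] P) : f = 0 := by
  have hle : ∀ g : S →ₗ[R] X, LinearMap.range g ≤ ⨆ f : S →ₗ[R] X, LinearMap.range f :=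
    fun g => le_iSup (fun f : S →ₗ[R] X => LinearMap.range f) g
  have h1 : (⨆ f : S →ₗ[R] X, LinearMap.range f) ≤ (LinearMap.ker f).map (Submodule.subtype _) := by
    refine iSup_le fun g => ?_
    rintro _ ⟨s, rfl⟩
    refine ⟨⟨g s, hle g ⟨s, rfl⟩⟩, ?_, rfl⟩
    exact LinearMap.congr_fun (hP (f ∘ₗ (g.codRestrict _ fun s => hle g ⟨s, rfl⟩))) s
  ext x
  obtain ⟨y, hy, hyx⟩ := h1 x.2
  have : y = x := Subtype.ext hyx
  rw [← this]
  exact hy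

section ComplexStructure

open TensorProduct

variable {R : Type*} [Ring R] [Algebra ℚ R]
  {X : Type*} [AddCommGroup X] [Module ℚ X] [Module R X]
  {Y : Type*} [AddCommGroup Y] [Module ℚ Y] [Module R Y]
  {Z : Type*} [AddCommGroup Z] [Module ℚ Z] [Module R Z]

/-- The real scalar extension of an `R`-linear map, for a `ℚ`-algebra `R`. -/
def realExt (f : X →ₗ[R] Y) : ℝ ⊗[ℚ] X →ₗ[ℝ] ℝ ⊗[ℚ] Y :=
  (f.restrictScalars ℚ).baseChange ℝ

/-- The action of `r : R` on the real scalar extension `ℝ ⊗ X` of an `R`-module `X`. -/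
def realSMul (X : Type*) [AddCommGroup X] [Module ℚ X] [Module R X] (r : R) :
    ℝ ⊗[ℚ] X →ₗ[ℝ] ℝ ⊗[ℚ] X :=
  (Algebra.lsmul ℚ ℚ X r).baseChange ℝ

@[simp] lemma realExt_tmul (f : X →ₗ[R] Y) (a : ℝ) (x : X) :
    realExt f (a ⊗ₜ x) = a ⊗ₜ f x := rfl

@[simp] lemma realSMul_tmul (r : R) (a : ℝ) (x : X) :
    realSMul X r (a ⊗ₜ x) = a ⊗ₜ (r • x) := rfl

lemma realExt_comp_apply (g : Y →ₗ[R] Z) (f : X →ₗ[R] Y) (z : ℝ ⊗[ℚ] X) :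
    realExt g (realExt f z) = realExt (g ∘ₗ f) z := by
  induction z with
  | zero => simp
  | tmul a x => simp
  | add x y hx hy => simp only [map_add, hx, hy]

lemma realExt_id_apply (z : ℝ ⊗[ℚ] X) : realExt (LinearMap.id : X →ₗ[R] X) z = z := by
  induction z with
  | zero => simp
  | tmul a x => simp
  | add x y hx hy => simp only [map_add, hx, hy]

lemma realExt_add_apply (f g : X →ₗ[R] Y) (z : ℝ ⊗[ℚ] X) :
    realExt (f + g) z = realExt f z + realExt g z := by
  induction z with
  | zero => simp
  | tmul a x => simp [tmul_add]
  | add x y hx hy => simp only [map_add, hx, hy]; abel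

lemma realExt_neg_apply (f : X →ₗ[R] Y) (z : ℝ ⊗[ℚ] X) :
    realExt (-f) z = -realExt f z := by
  induction z with
  | zero => simp
  | tmul a x => simp [tmul_neg]
  | add x y hx hy => simp only [map_add, hx, hy]; abel

lemma realExt_realSMul (f : X →ₗ[R] Y) (r : R) (z : ℝ ⊗[ℚ] X) :
    realExt f (realSMul X r z) = realSMul Y r (realExt f z) := by
  induction z with
  | zero => simp
  | tmul a x => simp
  | add x y hx hy => simp only [map_add, hx, hy]

variable (R) in
/-- A real-linear map between real scalar extensions of `R`-modules commutes with `R`. -/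
def IsRealEquivariant (Φ : ℝ ⊗[ℚ] X →ₗ[ℝ] ℝ ⊗[ℚ] Y) : Prop :=
  ∀ (r : R) (z : ℝ ⊗[ℚ] X), Φ (realSMul X r z) = realSMul Y r (Φ z)

lemma isRealEquivariant_realExt (f : X →ₗ[R] Y) : IsRealEquivariant R (realExt f) :=
  fun r z => realExt_realSMul f r z

lemma IsRealEquivariant.comp {Φ : ℝ ⊗[ℚ] Y →ₗ[ℝ] ℝ ⊗[ℚ] Z} {Ψ : ℝ ⊗[ℚ] X →ₗ[ℝ] ℝ ⊗[ℚ] Y}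
    (hΦ : IsRealEquivariant R Φ) (hΨ : IsRealEquivariant R Ψ) :
    IsRealEquivariant R (Φ ∘ₗ Ψ) := fun r z => by
  simp only [LinearMap.comp_apply, hΨ r z, hΦ r]

lemma IsRealEquivariant.add {Φ Ψ : ℝ ⊗[ℚ] X →ₗ[ℝ] ℝ ⊗[ℚ] Y}
    (hΦ : IsRealEquivariant R Φ) (hΨ : IsRealEquivariant R Ψ) :
    IsRealEquivariant R (Φ + Ψ) := fun r z => by
  simp only [LinearMap.add_apply, hΨ r z, hΦ r z, map_add]

/-- If there are no nonzero `R`-linear maps `X → Y`, then there are none between the real scalar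
extensions either: a nonzero one would have a nonzero coordinate with respect to a basis of `ℝ`
over `ℚ`. -/
lemma IsRealEquivariant.eq_zero {Φ : ℝ ⊗[ℚ] X →ₗ[ℝ] ℝ ⊗[ℚ] Y} (hΦ : IsRealEquivariant R Φ)
    (h : ∀ f : X →ₗ[R] Y, f = 0) : Φ = 0 := by
  let b := Module.Basis.ofVectorSpace ℚ ℝ
  have key : ∀ x : X, Φ (1 ⊗ₜ x) = 0 := by
    intro x
    apply (TensorProduct.equivFinsuppOfBasisLeft b).injective
    ext i
    rw [TensorProduct.equivFinsuppOfBasisLeft_apply, map_zero, Finsupp.zero_apply]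
    let c : ℝ ⊗[ℚ] Y →ₗ[ℚ] Y := (TensorProduct.lid ℚ Y).toLinearMap ∘ₗ (b.coord i).rTensor Y
    have hc : ∀ (r : R) (z : ℝ ⊗[ℚ] Y), c (realSMul Y r z) = r • c z := by
      intro r z
      induction z with
      | zero => simp
      | tmul a y =>
        simp only [realSMul_tmul, c, LinearMap.comp_apply, LinearMap.rTensor_tmul,
          LinearEquiv.coe_coe, TensorProduct.lid_tmul]
        rw [smul_algebra_smul_comm]
      | add x y hx hy => simp only [map_add, hx, hy, smul_add]
    let f : X →ₗ[R] Y :=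
      { toFun := fun x => c (Φ (1 ⊗ₜ x))
        map_add' := fun x y => by rw [tmul_add, map_add, map_add]
        map_smul' := fun r x => by
          rw [← realSMul_tmul, hΦ r, hc, RingHom.id_apply] }
    exact LinearMap.congr_fun (h f) x
  ext x
  simpa using key x

variable (R X) in
/-- The real scalar extension of the `R`-module `X` admits an `R`-invariant complex structure. -/
def HasComplexStructure : Prop :=
  ∃ J : ℝ ⊗[ℚ] X →ₗ[ℝ] ℝ ⊗[ℚ] X, IsRealEquivariant R J ∧ ∀ z, J (J z) = -z

lemma HasComplexStructure.congr (e : X ≃ₗ[R] Y) (h : HasComplexStructure R X) :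
    HasComplexStructure R Y := by
  obtain ⟨J, hJ, hJ2⟩ := h
  refine ⟨realExt e.toLinearMap ∘ₗ J ∘ₗ realExt e.symm.toLinearMap,
    (isRealEquivariant_realExt _).comp (hJ.comp (isRealEquivariant_realExt _)), fun z => ?_⟩
  have h1 : ∀ w, realExt e.symm.toLinearMap (realExt e.toLinearMap w) = w := fun w => by
    rw [realExt_comp_apply, LinearEquiv.symm_comp, realExt_id_apply]
  have h2 : ∀ w, realExt e.toLinearMap (realExt e.symm.toLinearMap w) = w := fun w => by
    rw [realExt_comp_apply, LinearEquiv.comp_symm, realExt_id_apply]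
  simp only [LinearMap.comp_apply, h1, hJ2, map_neg, h2]

/-- On the real scalar extension of `X × X`, the map `(x, y) ↦ (-y, x)` is a complex structure. -/
lemma hasComplexStructure_prod_self : HasComplexStructure R (X × X) := by
  let j : X × X →ₗ[R] X × X := LinearMap.prod (-LinearMap.snd R X X) (LinearMap.fst R X X)
  refine ⟨realExt j, isRealEquivariant_realExt _, fun z => ?_⟩
  have : j ∘ₗ j = -LinearMap.id := by ext <;> simp [j]
  rw [realExt_comp_apply, this, realExt_neg_apply, realExt_id_apply]

lemma HasComplexStructure.prod (hX : HasComplexStructure R X) (hY : HasComplexStructure R Y) :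
    HasComplexStructure R (X × Y) := by
  obtain ⟨J, hJ, hJ2⟩ := hX
  obtain ⟨K, hK, hK2⟩ := hY
  refine ⟨realExt (LinearMap.inl R X Y) ∘ₗ J ∘ₗ realExt (LinearMap.fst R X Y) +
      realExt (LinearMap.inr R X Y) ∘ₗ K ∘ₗ realExt (LinearMap.snd R X Y),
    ((isRealEquivariant_realExt _).comp (hJ.comp (isRealEquivariant_realExt _))).add
      ((isRealEquivariant_realExt _).comp (hK.comp (isRealEquivariant_realExt _))), fun z => ?_⟩
  have z1 : ∀ w : ℝ ⊗[ℚ] Y, realExt (0 : Y →ₗ[R] X) w = 0 := fun w => by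
    simp [realExt]
  have z2 : ∀ w : ℝ ⊗[ℚ] X, realExt (0 : X →ₗ[R] Y) w = 0 := fun w => by
    simp [realExt]
  simp only [LinearMap.comp_apply, LinearMap.add_apply, map_add, realExt_comp_apply,
    LinearMap.fst_comp_inl, LinearMap.snd_comp_inr, LinearMap.fst_comp_inr, LinearMap.snd_comp_inl,
    realExt_id_apply, z1, z2, map_zero, add_zero, zero_add, hJ2, hK2, map_neg]
  rw [← neg_add, ← realExt_add_apply]
  have : LinearMap.inl R X Y ∘ₗ LinearMap.fst R X Y + LinearMap.inr R X Y ∘ₗ LinearMap.snd R X Y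
      = LinearMap.id := by ext <;> simp
  rw [this, realExt_id_apply]

/-- If `Hom(X, Y) = 0`, a complex structure on `X × Y` is block triangular, so that its diagonal
blocks are complex structures on `X` and `Y`. -/
lemma HasComplexStructure.of_prod (h : HasComplexStructure R (X × Y))
    (hXY : ∀ f : X →ₗ[R] Y, f = 0) : HasComplexStructure R X ∧ HasComplexStructure R Y := by
  obtain ⟨J, hJ, hJ2⟩ := h
  have h0 : ∀ z, realExt (LinearMap.snd R X Y) (J (realExt (LinearMap.inl R X Y) z)) = 0 := by
    intro z
    exact LinearMap.congr_fun (((isRealEquivariant_realExt (LinearMap.snd R X Y)).comp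
      (hJ.comp (isRealEquivariant_realExt (LinearMap.inl R X Y)))).eq_zero hXY) z
  have hid : ∀ w : ℝ ⊗[ℚ] (X × Y), w = realExt (LinearMap.inl R X Y)
      (realExt (LinearMap.fst R X Y) w) +
      realExt (LinearMap.inr R X Y) (realExt (LinearMap.snd R X Y) w) := fun w => by
    have : LinearMap.inl R X Y ∘ₗ LinearMap.fst R X Y + LinearMap.inr R X Y ∘ₗ LinearMap.snd R X Y
      = LinearMap.id := by ext <;> simp
    rw [realExt_comp_apply, realExt_comp_apply, ← realExt_add_apply, this, realExt_id_apply]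
  constructor
  · refine ⟨realExt (LinearMap.fst R X Y) ∘ₗ J ∘ₗ realExt (LinearMap.inl R X Y),
      (isRealEquivariant_realExt _).comp (hJ.comp (isRealEquivariant_realExt _)), fun z => ?_⟩
    have h1 := hid (J (realExt (LinearMap.inl R X Y) z))
    rw [h0, map_zero, add_zero] at h1
    simp only [LinearMap.comp_apply]
    rw [← h1, hJ2, map_neg, realExt_comp_apply, LinearMap.fst_comp_inl, realExt_id_apply]
  · refine ⟨realExt (LinearMap.snd R X Y) ∘ₗ J ∘ₗ realExt (LinearMap.inr R X Y),
      (isRealEquivariant_realExt _).comp (hJ.comp (isRealEquivariant_realExt _)), fun z => ?_⟩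
    have h1 := hid (J (realExt (LinearMap.inr R X Y) z))
    have h2 := congrArg (fun w => realExt (LinearMap.snd R X Y) (J w)) h1
    simp only [map_add, h0, zero_add, hJ2, map_neg, realExt_comp_apply (LinearMap.snd R X Y)
      (LinearMap.inr R X Y), LinearMap.snd_comp_inr, realExt_id_apply] at h2
    exact h2.symm

/-- Cancellation of complex structures: the part of `X` isotypic to `S` inherits one from `X × N`,
the complementary part inherits one from `X × S`. -/
lemma HasComplexStructure.cancel [IsSemisimpleRing R] {S N : Type*}
    [AddCommGroup S] [Module ℚ S] [Module R S]
    [AddCommGroup N] [Module ℚ N] [Module R N]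
    (hSN : ∀ f : S →ₗ[R] N, f = 0) (hN : HasComplexStructure R (X × N))
    (hS : HasComplexStructure R (X × S)) : HasComplexStructure R X := by
  -- `T` is the trace of `S` in `X`
  let T : Submodule R X := ⨆ f : S →ₗ[R] X, LinearMap.range f
  obtain ⟨C, hC⟩ := exists_isCompl T
  have hle : ∀ f : S →ₗ[R] X, LinearMap.range f ≤ T := fun f =>
    le_iSup (fun f : S →ₗ[R] X => LinearMap.range f) f
  have hSC : ∀ f : S →ₗ[R] C, f = 0 := by
    intro f
    ext s
    have h1 : (f s : X) ∈ T := hle (C.subtype ∘ₗ f) ⟨s, rfl⟩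
    have := Submodule.disjoint_def.1 hC.disjoint _ h1 (f s).2
    simpa using this
  let e : (T × C) ≃ₗ[R] X := Submodule.prodEquivOfIsCompl T C hC
  have cT : HasComplexStructure R T := by
    have h1 : HasComplexStructure R (T × (C × N)) :=
      hN.congr ((LinearEquiv.prodCongr e.symm (LinearEquiv.refl R N)).trans
        (LinearEquiv.prodAssoc R T C N))
    refine (h1.of_prod fun f => ?_).1
    have a1 : LinearMap.fst R C N ∘ₗ f = 0 := hom_trace_eq_zero hSC _
    have a2 : LinearMap.snd R C N ∘ₗ f = 0 := hom_trace_eq_zero hSN _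
    ext x
    · exact congrArg Subtype.val (LinearMap.congr_fun a1 x)
    · exact LinearMap.congr_fun a2 x
  have cC : HasComplexStructure R C := by
    have h1 : HasComplexStructure R ((S × T) × C) :=
      hS.congr ((LinearEquiv.prodComm R X S).trans
        ((LinearEquiv.prodCongr (LinearEquiv.refl R S) e.symm).trans
        (LinearEquiv.prodAssoc R S T C).symm))
    refine (h1.of_prod fun f => ?_).2
    have a1 : f ∘ₗ LinearMap.inl R S T = 0 := hSC _
    have a2 : f ∘ₗ LinearMap.inr R S T = 0 := hom_trace_eq_zero hSC _
    exact LinearMap.prod_ext (by simpa using a1) (by simpa using a2)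
  exact (cT.prod cC).congr e

/-- Every submodule `N` of a semisimple module `V` with a complex structure contains a submodule
`N'`, of at most twice the codimension of `N`, such that `V ⧸ N'` has a complex structure.
If `Q` is a complement of `N` and `j : Q → N` has the smallest possible kernel, then a complement
`N'` of `j(Q)` in `N` will do, because `V ⧸ N' × N' ≃ V`, `V ⧸ N' × ker j ≃ Q × Q` and
`Hom(ker j, N') = 0`. -/
theorem HasComplexStructure.exists_le_quotient [IsSemisimpleRing R] {V : Type*}
    [AddCommGroup V] [Module ℚ V] [Module R V] [Module.Finite ℚ V]
    (hV : HasComplexStructure R V) (N : Submodule R V) :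
    ∃ N' : Submodule R V, N' ≤ N ∧ HasComplexStructure R (V ⧸ N') ∧
      Module.finrank ℚ (V ⧸ N') ≤ 2 * Module.finrank ℚ (V ⧸ N) := by
  obtain ⟨Q, hQ⟩ := exists_isCompl N
  have fin : ∀ P : Submodule R V, Module.Finite ℚ P := fun P =>
    inferInstanceAs (Module.Finite ℚ (P.restrictScalars ℚ))
  obtain ⟨j, hj⟩ : ∃ j : Q →ₗ[R] N, ∀ j' : Q →ₗ[R] N,
      Module.finrank ℚ (LinearMap.ker j) ≤ Module.finrank ℚ (LinearMap.ker j') := by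
    obtain ⟨j, -, hj⟩ := WellFounded.has_min
      (InvImage.wf (fun j : Q →ₗ[R] N => Module.finrank ℚ (LinearMap.ker j)) Nat.lt_wfRel.wf)
      Set.univ ⟨0, trivial⟩
    exact ⟨j, fun j' => not_lt.1 (hj j' trivial)⟩
  obtain ⟨M, hM⟩ := exists_isCompl (LinearMap.range j)
  obtain ⟨C, hC⟩ := exists_isCompl (LinearMap.ker j)
  -- modifying `j` on its kernel by a nonzero map into `M` would shrink the kernel
  have hom0 : ∀ f : LinearMap.ker j →ₗ[R] M, f = 0 := by
    intro f
    let pr : Q →ₗ[R] LinearMap.ker j := Submodule.projectionOnto _ _ hC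
    let j' : Q →ₗ[R] N := j + M.subtype ∘ₗ f ∘ₗ pr
    have hker : LinearMap.ker j' ≤ (LinearMap.ker f).map (LinearMap.ker j).subtype := by
      intro x hx
      have hx' : j x + (f (pr x) : N) = 0 := hx
      have h1 : j x ∈ M := by
        rw [eq_neg_of_add_eq_zero_left hx']
        exact M.neg_mem (f (pr x)).2
      have h2 : j x = 0 := Submodule.disjoint_def.1 hM.disjoint _ ⟨x, rfl⟩ h1
      have h3 : f (pr x) = 0 := by
        rw [h2, zero_add] at hx'
        exact Subtype.ext hx'
      have h4 : pr x = ⟨x, h2⟩ :=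
        Submodule.projectionOnto_apply_left hC ⟨x, h2⟩
      rw [h4] at h3
      exact ⟨⟨x, h2⟩, h3, rfl⟩
    have finQ : ∀ P : Submodule R Q, Module.Finite ℚ P := fun P =>
      inferInstanceAs (Module.Finite ℚ (P.restrictScalars ℚ))
    have h5 : Module.finrank ℚ (LinearMap.ker j') ≤
        Module.finrank ℚ (LinearMap.ker (f.restrictScalars ℚ)) := by
      have e1 : Module.finrank ℚ (LinearMap.ker (f.restrictScalars ℚ)) =
          Module.finrank ℚ (((LinearMap.ker f).map (LinearMap.ker j).subtype).restrictScalars ℚ) :=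
        LinearEquiv.finrank_eq (((LinearMap.ker f).equivMapOfInjective _
          (LinearMap.ker j).injective_subtype).restrictScalars ℚ)
      rw [e1]
      exact Submodule.finrank_mono
        (s := (LinearMap.ker j').restrictScalars ℚ) (fun x hx => hker hx)
    have h6 := LinearMap.finrank_range_add_finrank_ker (f.restrictScalars ℚ)
    have h7 := hj j'
    have h8 : Module.finrank ℚ (LinearMap.range (f.restrictScalars ℚ)) = 0 := by omega
    have h9 := Submodule.finrank_eq_zero.1 h8
    ext x
    have : f x ∈ LinearMap.range (f.restrictScalars ℚ) := ⟨x, rfl⟩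
    rw [h9] at this
    simpa using this
  let N' : Submodule R V := M.map N.subtype
  have hN'N : N' ≤ N := Submodule.map_subtype_le N M
  let eN' : M ≃ₗ[R] N' := M.equivMapOfInjective _ N.injective_subtype
  -- a complement of `N'`
  obtain ⟨X, hX⟩ := exists_isCompl N'
  let eX : (V ⧸ N') ≃ₗ[R] X := Submodule.quotientEquivOfIsCompl N' X hX
  let ej : (LinearMap.range j × M) ≃ₗ[R] N := Submodule.prodEquivOfIsCompl _ _ hM
  let eV : (N × Q) ≃ₗ[R] V := Submodule.prodEquivOfIsCompl _ _ hQ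
  -- `V ⧸ N' ≃ j(Q) × Q`
  have eVN : Nonempty ((V ⧸ N') ≃ₗ[R] LinearMap.range j × Q) := by
    let q : V →ₗ[R] LinearMap.range j × Q :=
      LinearMap.prodMap (LinearMap.fst R _ _ ∘ₗ ej.symm.toLinearMap) LinearMap.id ∘ₗ
        eV.symm.toLinearMap
    have hq : Function.Surjective q := by
      rintro ⟨a, b⟩
      refine ⟨eV (ej (a, 0), b), ?_⟩
      simp [q]
    have hk : LinearMap.ker q = N' := by
      ext v
      obtain ⟨⟨n, b⟩, rfl⟩ := eV.surjective v
      obtain ⟨⟨a, m⟩, rfl⟩ := ej.surjective n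
      have e1 : q (eV (ej (a, m), b)) = (a, b) := by simp [q]
      have e2 : eV (ej (a, m), b) = ((a : N) : V) + ((m : N) : V) + (b : V) := by
        simp [eV, ej]
      rw [LinearMap.mem_ker, e1, e2]
      constructor
      · intro h
        obtain ⟨rfl, rfl⟩ := Prod.mk.inj h
        simp [N']
      · rintro ⟨m', hm', h⟩
        have h1 : (b : V) ∈ N := by
          have : (b : V) = (m' : V) - (((a : N) : V) + ((m : N) : V)) := by
            rw [← N.subtype_apply m', h]; abel
          rw [this]
          exact N.sub_mem m'.2 (N.add_mem (a : N).2 (m : N).2)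
        have h2 : (b : V) = 0 := Submodule.disjoint_def.1 hQ.disjoint _ h1 b.2
        have h3 : (a : N) ∈ M := by
          have : (a : N) = m' - (m : N) := by
            apply Subtype.ext
            rw [h2, add_zero] at h
            simp only [Submodule.subtype_apply] at h
            simp [h]
          rw [this]
          exact M.sub_mem hm' m.2
        have h4 : (a : N) = 0 := Submodule.disjoint_def.1 hM.disjoint _ a.2 h3
        exact Prod.ext (Subtype.ext h4) (Subtype.ext h2)
    exact ⟨(Submodule.quotEquivOfEq _ _ hk.symm).trans (q.quotKerEquivOfSurjective hq)⟩
  obtain ⟨eVN⟩ := eVN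
  refine ⟨N', hN'N, ?_, ?_⟩
  · refine HasComplexStructure.cancel hom0 (hV.congr ?_)
      (HasComplexStructure.congr ?_ (hasComplexStructure_prod_self (R := R) (X := Q)))
    · exact (Submodule.prodEquivOfIsCompl _ _ hX).symm.trans
        ((LinearEquiv.prodComm R _ _).trans (LinearEquiv.prodCongr eX.symm eN'.symm))
    · -- `Q ≃ ker j × j(Q)`
      let eC : C ≃ₗ[R] LinearMap.range j :=
        (Submodule.quotientEquivOfIsCompl _ _ hC).symm.trans j.quotKerEquivRange
      let eQ : Q ≃ₗ[R] LinearMap.range j × LinearMap.ker j :=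
        (Submodule.prodEquivOfIsCompl _ _ hC).symm.trans
          ((LinearEquiv.prodComm R _ _).trans
            (LinearEquiv.prodCongr eC (LinearEquiv.refl R _)))
      exact (LinearEquiv.prodCongr (LinearEquiv.refl R Q) eQ).trans
        ((LinearEquiv.prodAssoc R _ _ _).symm.trans
          (LinearEquiv.prodCongr ((LinearEquiv.prodComm R _ _).trans eVN.symm)
            (LinearEquiv.refl R _)))
  · have e1 := (eVN.restrictScalars ℚ).finrank_eq
    have e2 := ((Submodule.quotientEquivOfIsCompl N Q hQ).restrictScalars ℚ).finrank_eq
    have finr : Module.Finite ℚ (LinearMap.range j) :=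
      inferInstanceAs (Module.Finite ℚ (LinearMap.range (j.restrictScalars ℚ)))
    have e3 : Module.finrank ℚ (LinearMap.range j) ≤ Module.finrank ℚ Q :=
      LinearMap.finrank_range_le (j.restrictScalars ℚ)
    rw [e1, e2, Module.finrank_prod]
    omega

end ComplexStructure

/-! ### Special classes in terms of cocycles -/

section Cocycles

open groupCohomology

variable {G : Type} [Group G]

/-- A class in `H²(G, A)` is special if and only if a representing cocycle does not become a
coboundary on any nontrivial subgroup. -/
lemma isSpecialClass_H2π_iff {A : Rep.{0} ℤ G} (σ : cocycles₂ A) :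
    IsSpecialClass (H2π A σ) ↔ ∀ H : Subgroup G, H ≠ ⊥ →
      ¬ ∃ τ : H → A, ∀ g h : H, σ ((g : G), (h : G)) = A.ρ g (τ h) - τ (g * h) + τ g := by
  unfold IsSpecialClass
  refine forall₂_congr fun H _ => not_congr ?_
  have h1 : (groupCohomology.map H.subtype (𝟙 (Rep.res H.subtype A)) 2).hom (H2π A σ) =
      H2π (Rep.res H.subtype A) (mapCocycles₂ H.subtype (𝟙 (Rep.res H.subtype A)) σ) :=
    H2π_comp_map_apply H.subtype (𝟙 (Rep.res H.subtype A)) σ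
  rw [h1, H2π_eq_zero_iff]
  constructor
  · rintro ⟨τ, hτ⟩
    refine ⟨τ, fun g h => ?_⟩
    exact (congrFun hτ (g, h)).symm
  · rintro ⟨τ, hτ⟩
    refine ⟨τ, ?_⟩
    ext ⟨g, h⟩
    exact (hτ g h).symm

/-- The image in `H²(G, B)` of the class of a cocycle `σ` is special if and only if the image of
`σ` does not become a coboundary on any nontrivial subgroup. -/
lemma isSpecialClass_map_iff {A B : Rep.{0} ℤ G} (φ : A ⟶ B) (σ : cocycles₂ A) :
    IsSpecialClass ((groupCohomology.map (B := B) (MonoidHom.id G) φ 2).hom (H2π A σ)) ↔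
      ∀ H : Subgroup G, H ≠ ⊥ → ¬ ∃ τ : H → B, ∀ g h : H,
        φ.hom (σ ((g : G), (h : G))) = B.ρ g (τ h) - τ (g * h) + τ g := by
  have h1 : (groupCohomology.map (B := B) (MonoidHom.id G) φ 2).hom (H2π A σ) =
      H2π B (mapCocycles₂ (B := B) (MonoidHom.id G) φ σ) :=
    H2π_comp_map_apply (B := B) (MonoidHom.id G) φ σ
  rw [h1, isSpecialClass_H2π_iff]
  rfl

/-- The image in `H²(G, A ⧸ N)` of the class of a cocycle `σ` is special if and only if `σ` does
not become a coboundary modulo `N` on any nontrivial subgroup. -/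
lemma isSpecialClass_map_mkQ_iff {A : Type} [AddCommGroup A] (ρ : Representation ℤ G A)
    (N : Submodule ℤ A) (hN : ∀ g : G, N ≤ N.comap (ρ g)) (σ : cocycles₂ (Rep.of ρ)) :
    IsSpecialClass ((groupCohomology.map (B := Rep.quotient (Rep.of ρ) N hN) (MonoidHom.id G)
        (Rep.mkQ (Rep.of ρ) N hN) 2).hom (H2π (Rep.of ρ) σ)) ↔
      ∀ H : Subgroup G, H ≠ ⊥ → ¬ ∃ τ : H → A ⧸ N, ∀ g h : H,
        N.mkQ (σ ((g : G), (h : G))) = ρ.quotient N hN g (τ h) - τ (g * h) + τ g :=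
  isSpecialClass_map_iff (B := Rep.quotient (Rep.of ρ) N hN) (Rep.mkQ (Rep.of ρ) N hN) σ

end Cocycles

/-! ### Existence of the Vasquez number -/

section Vasquez

open groupCohomology

variable {G : Type} [Group G] {A : Type} [AddCommGroup A] {ρ : Representation ℤ G A}

/-- A telescoping form of the cocycle identity on the powers of `c`. -/
lemma cocycle_apply_pow (σ : cocycles₂ (Rep.of ρ)) (c : G) (i k : ℕ) :
    σ (c ^ i, c ^ k) = ∑ j ∈ Finset.range (i + k), σ (c ^ j, c) -
      ∑ j ∈ Finset.range i, σ (c ^ j, c) - ρ (c ^ i) (∑ j ∈ Finset.range k, σ (c ^ j, c)) +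
      ρ (c ^ i) (σ (1, 1)) := by
  induction k with
  | zero =>
    have := cocycles₂_map_one_snd σ (c ^ i)
    simpa using this
  | succ k ih =>
    have h := (mem_cocycles₂_iff (A := Rep.of ρ) σ).1 σ.2 (c ^ i) (c ^ k) c
    rw [← pow_add, ← pow_succ] at h
    change σ (c ^ (i + k), c) + σ (c ^ i, c ^ k) =
      ρ (c ^ i) (σ (c ^ k, c)) + σ (c ^ i, c ^ (k + 1)) at h
    rw [← add_assoc, Finset.sum_range_succ, Finset.sum_range_succ, map_add,
      eq_sub_of_add_eq' h.symm, ih]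
    abel

/-- The sum `∑ σ(cʲ, c)` over a full period of `c` classifies the restriction of the class of `σ`
to the cyclic group generated by `c`, up to norms. If it is a norm, the restriction is zero. -/
lemma exists_coboundary_zpowers (σ : cocycles₂ (Rep.of ρ)) (c : G) (hc : IsOfFinOrder c) (x : A)
    (hx : ∑ j ∈ Finset.range (orderOf c), σ (c ^ j, c) =
      ∑ j ∈ Finset.range (orderOf c), ρ (c ^ j) x) :
    ∃ τ : Subgroup.zpowers c → A, ∀ g h : Subgroup.zpowers c,
      σ ((g : G), (h : G)) = ρ g (τ h) - τ (g * h) + τ g := by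
  set T : ℕ → A := fun k => ∑ j ∈ Finset.range k, σ (c ^ j, c) with hT
  set v : ℕ → A := fun k => ∑ j ∈ Finset.range k, ρ (c ^ j) x with hv
  have hTσ : ∀ i k, σ (c ^ i, c ^ k) = T (i + k) - T i - ρ (c ^ i) (T k) + ρ (c ^ i) (σ (1, 1)) :=
    fun i k => cocycle_apply_pow σ c i k
  have hv_add : ∀ i k, v (i + k) = v i + ρ (c ^ i) (v k) := by
    intro i k
    simp only [hv, Finset.sum_range_add, map_sum, pow_add, map_mul, Module.End.mul_apply]
  let w : ℕ → A := fun k => -T k + σ (1, 1) + v k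
  have hw : ∀ i k, σ (c ^ i, c ^ k) = ρ (c ^ i) (w k) - w (i + k) + w i := by
    intro i k
    simp only [w, hTσ, hv_add, map_add, map_neg]
    abel
  have hper : Function.Periodic w (orderOf c) := by
    intro k
    have h1 := hTσ (orderOf c) k
    have h2 : σ (1, c ^ k) = σ (1, 1) := cocycles₂_map_one_fst σ (c ^ k)
    have h3 := hv_add (orderOf c) k
    rw [pow_orderOf_eq_one, map_one, Module.End.one_apply] at h3
    rw [pow_orderOf_eq_one, map_one, Module.End.one_apply, Module.End.one_apply, h2] at h1
    have h4 : T (orderOf c + k) = T (orderOf c) + T k := by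
      have h5 : T (orderOf c + k) - T (orderOf c) - T k = 0 := by simpa using h1
      rw [← sub_eq_zero, ← h5]; abel
    have h5 : T (orderOf c) = v (orderOf c) := hx
    simp only [w]
    rw [add_comm k, h4, h3, h5]
    abel
  have hex : ∀ g : Subgroup.zpowers c, ∃ k : ℕ, c ^ k = g := fun g => by
    have := (hc.mem_powers_iff_mem_zpowers).2 g.2
    exact this
  choose m hm using hex
  have hwm : ∀ k k', c ^ k = c ^ k' → w k = w k' := by
    intro k k' h
    rw [← hper.map_mod_nat k, ← hper.map_mod_nat k', (pow_eq_pow_iff_modEq.1 h : _ % _ = _ % _)]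
  refine ⟨fun g => w (m g), fun g h => ?_⟩
  have h1 : w (m (g * h)) = w (m g + m h) := by
    apply hwm
    rw [hm, pow_add, hm, hm, Subgroup.coe_mul]
  calc σ ((g : G), (h : G)) = σ (c ^ m g, c ^ m h) := by rw [hm, hm]
    _ = ρ g (w (m h)) - w (m g + m h) + w (m g) := by rw [hw, hm]
    _ = _ := by rw [← h1]

lemma sum_cocycle_invariant (σ : cocycles₂ (Rep.of ρ)) (c : G) :
    ρ c (∑ j ∈ Finset.range (orderOf c), σ (c ^ j, c)) =
      ∑ j ∈ Finset.range (orderOf c), σ (c ^ j, c) := by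
  have h1 := cocycle_apply_pow σ c 1 (orderOf c)
  have h2 := cocycles₂_map_one_snd σ c
  change σ (c, 1) = ρ c (σ (1, 1)) at h2
  rw [pow_orderOf_eq_one, pow_one, h2, add_comm 1, Finset.sum_range_succ, pow_orderOf_eq_one,
    Finset.sum_range_one, pow_zero] at h1
  have h3 := add_eq_right.1 h1.symm
  rw [add_sub_cancel_right, sub_eq_zero] at h3
  exact h3.symm

/-- The perfect pairing between the Tate cohomology groups in degree zero of a lattice and of its
dual, for a cyclic group: an invariant element `a` which is not a norm is detected by an invariant
functional. As `n • a` is a norm which is not `n` times a norm, a suitable functional on the lattice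
of norms, composed with the norm, will do. -/
lemma exists_invariant_functional [Module.Free ℤ A] [Module.Finite ℤ A] (c : G)
    (hc : IsOfFinOrder c) (a : A) (ha : ρ c a = a)
    (hna : ∀ x, a ≠ ∑ j ∈ Finset.range (orderOf c), ρ (c ^ j) x) :
    ∃ f : A →ₗ[ℤ] ℤ, (∀ x, f (ρ c x) = f x) ∧ ¬ (orderOf c : ℤ) ∣ f a := by
  let Nm : A →ₗ[ℤ] A := ∑ j ∈ Finset.range (orderOf c), ρ (c ^ j)
  have hNm : ∀ x, Nm x = ∑ j ∈ Finset.range (orderOf c), ρ (c ^ j) x := fun x => by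
    simp [Nm]
  have hinv : ∀ x, Nm (ρ c x) = Nm x := by
    intro x
    have h1 : ∀ j, ρ (c ^ j) (ρ c x) = ρ (c ^ (j + 1)) x := fun j => by
      rw [pow_succ, map_mul, Module.End.mul_apply]
    have h2 := Finset.sum_range_succ (fun j => ρ (c ^ j) x) (orderOf c)
    rw [Finset.sum_range_succ', pow_zero, pow_orderOf_eq_one] at h2
    rw [hNm, hNm]
    simp only [h1]
    exact add_right_cancel h2
  have hNa : Nm a = (orderOf c : ℤ) • a := by
    have h1 : ∀ j : ℕ, ρ (c ^ j) a = a := fun j => by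
      induction j with
      | zero => simp
      | succ j ih => rw [pow_succ, map_mul, Module.End.mul_apply, ha, ih]
    rw [hNm, Finset.sum_congr rfl fun j _ => h1 j]
    simp
  let b := Module.Free.chooseBasis ℤ (LinearMap.range Nm)
  have hn0 : (orderOf c : ℤ) ≠ 0 := by
    exact_mod_cast hc.orderOf_pos.ne'
  obtain ⟨i, hi⟩ : ∃ i, ¬ (orderOf c : ℤ) ∣ b.repr (Nm.rangeRestrict a) i := by
    by_contra! hall
    choose z hz using hall
    have h1 : Nm.rangeRestrict a = (orderOf c : ℤ) • ∑ i, z i • b i := by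
      rw [← b.sum_repr (Nm.rangeRestrict a), Finset.smul_sum]
      refine Finset.sum_congr rfl fun i _ => ?_
      rw [hz i, mul_smul]
    have h2 : (orderOf c : ℤ) • a = (orderOf c : ℤ) • ((∑ i, z i • b i : LinearMap.range Nm) : A) :=
      by rw [← hNa]; exact congrArg Subtype.val h1
    have h3 := smul_right_injective A hn0 h2
    obtain ⟨x, hx⟩ := (∑ i, z i • b i : LinearMap.range Nm).2
    exact hna x (by rw [← hNm, hx, ← h3])
  refine ⟨b.coord i ∘ₗ Nm.rangeRestrict, fun x => ?_, hi⟩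
  have : Nm.rangeRestrict (ρ c x) = Nm.rangeRestrict x := Subtype.ext (hinv x)
  rw [LinearMap.comp_apply, this, LinearMap.comp_apply]

/-- Vasquez's theorem: a special class stays special after passing to a quotient of rank at most
`|G|²`. For every `c ≠ 1` there is a `c`-invariant functional which detects the restriction of the
class to the group generated by `c`; one divides by the common kernel of all translates of these
functionals. -/
theorem isVasquezBound_card_sq (G : Type) [Group G] [Finite G] :
    IsVasquezBound G (Nat.card G * Nat.card G) := by
  have := Fintype.ofFinite G
  intro A _ _ _ ρ _ α hα
  induction α using H2_induction_on with | h σ =>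
  rw [isSpecialClass_H2π_iff] at hα
  have hf : ∀ c : G, ∃ f : A →ₗ[ℤ] ℤ, (∀ x, f (ρ c x) = f x) ∧
      (c ≠ 1 → ¬ (orderOf c : ℤ) ∣ f (∑ j ∈ Finset.range (orderOf c), σ (c ^ j, c))) := by
    intro c
    by_cases hc : c = 1
    · exact ⟨0, by simp, fun h => absurd hc h⟩
    · obtain ⟨f, h1, h2⟩ := exists_invariant_functional (ρ := ρ) c (isOfFinOrder_of_finite c)
        (∑ j ∈ Finset.range (orderOf c), σ (c ^ j, c)) (sum_cocycle_invariant σ c)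
        (fun x hx => hα (Subgroup.zpowers c) (by simpa using hc)
          (exists_coboundary_zpowers σ c (isOfFinOrder_of_finite c) x hx))
      exact ⟨f, h1, fun _ => h2⟩
  choose f hfinv hfdvd using hf
  let Φ : A →ₗ[ℤ] (G → G → ℤ) := LinearMap.pi fun c => LinearMap.pi fun g => f c ∘ₗ ρ g
  have hΦ : ∀ x c g, Φ x c g = f c (ρ g x) := fun x c g => rfl
  have hN : ∀ g : G, LinearMap.ker Φ ≤ (LinearMap.ker Φ).comap (ρ g) := by
    intro g x hx
    rw [Submodule.mem_comap, LinearMap.mem_ker]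
    ext c h
    have := congrFun (congrFun (LinearMap.mem_ker.1 hx) c) (h * g)
    rwa [hΦ, map_mul] at this
  refine ⟨LinearMap.ker Φ, hN, fun m a hm ha => ?_, ?_, ?_⟩
  · rw [LinearMap.mem_ker, map_smul] at ha
    exact (smul_eq_zero.1 ha).resolve_left hm
  · rw [Φ.quotKerEquivRange.finrank_eq]
    refine (Submodule.finrank_le _).trans ?_
    simp [Module.finrank_pi_fintype, Nat.card_eq_fintype_card]
  · rw [isSpecialClass_map_mkQ_iff]
    rintro H hH ⟨τ, hτ⟩
    obtain ⟨c, hc'⟩ := H.ne_bot_iff_exists_ne_one.1 hH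
    have hc : (c : G) ≠ 1 := fun h => hc' (Subtype.ext h)
    let F : A ⧸ LinearMap.ker Φ →ₗ[ℤ] ℤ := (LinearMap.ker Φ).liftQ (f c) fun x hx => by
      have := congrFun (congrFun (LinearMap.mem_ker.1 hx) (c : G)) 1
      rwa [hΦ, map_one] at this
    have hF : ∀ x, F ((LinearMap.ker Φ).mkQ x) = f c x := fun x => rfl
    have hFinv : ∀ y, F (ρ.quotient _ hN c y) = F y := by
      intro y
      obtain ⟨x, rfl⟩ := (LinearMap.ker Φ).mkQ_surjective y
      exact hfinv c x
    have hFpow : ∀ (j : ℕ) y, F (ρ.quotient _ hN ((c : G) ^ j) y) = F y := by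
      intro j
      induction j with
      | zero => intro y; rw [pow_zero, map_one, Module.End.one_apply]
      | succ j ih => intro y; rw [pow_succ, map_mul, Module.End.mul_apply, ih, hFinv]
    refine hfdvd c hc ⟨F (τ c), ?_⟩
    have h1 : ∀ j : ℕ, f c (σ ((c : G) ^ j, c)) =
        F (τ c) - (F (τ (c ^ (j + 1))) - F (τ (c ^ j))) := by
      intro j
      have := congrArg F (hτ (c ^ j) c)
      rw [hF, map_add, map_sub, ← pow_succ, Subgroup.coe_pow, hFpow] at this
      rw [this]; ring
    have h2 : c ^ orderOf (c : G) = 1 := Subtype.ext (by simp [pow_orderOf_eq_one])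
    rw [map_sum, Finset.sum_congr rfl fun j _ => h1 j, Finset.sum_sub_distrib,
      Finset.sum_range_sub (fun j => F (τ (c ^ j))), h2, pow_zero]
    simp

end Vasquez

/-! ### Holomorphic maps of complex tori lift to affine maps -/

section Torus

/-- The complex vector space `ℂⁿ`. -/
abbrev CSpace (n : ℕ) : Type := EuclideanSpace ℂ (Fin n)

variable {n : ℕ} {Λ : Submodule ℤ (CSpace n)}

lemma isCoveringMap_mkQ [DiscreteTopology Λ] : IsCoveringMap Λ.mkQ := by
  have h : Topology.IsQuotientMap (Λ.mkQ.toAddMonoidHom : CSpace n → CSpace n ⧸ Λ) :=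
    Λ.isQuotientMap_mkQ
  have hk : (Λ.mkQ.toAddMonoidHom.ker : Set (CSpace n)) = Λ := by
    ext z
    exact Submodule.Quotient.mk_eq_zero Λ
  exact (h.isAddQuotientCoveringMap_of_isDiscrete_ker_addMonoidHom
    (by rw [hk]; exact ⟨inferInstanceAs (DiscreteTopology Λ)⟩)).isCoveringMap

/-- Continuous maps on a connected space which agree modulo the lattice differ by a constant. -/
lemma eq_of_continuous_of_sub_mem [DiscreteTopology Λ] {Y : Type*} [TopologicalSpace Y]
    [PreconnectedSpace Y] {f g : Y → CSpace n} (hf : Continuous f) (hg : Continuous g)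
    (h : ∀ y, f y - g y ∈ Λ) (y y' : Y) : f y - g y = f y' - g y' := by
  have hc : Continuous fun y => (⟨f y - g y, h y⟩ : Λ) := (hf.sub hg).subtype_mk _
  exact congrArg Subtype.val (PreconnectedSpace.constant inferInstance hc)

lemma exists_pos_forall_norm_lt_eq_zero (Λ : Submodule ℤ (CSpace n)) [DiscreteTopology Λ] :
    ∃ r > 0, ∀ l ∈ Λ, ‖l‖ < r → l = 0 := by
  have h1 : ({0} : Set Λ) ∈ 𝓝 0 := (isOpen_discrete _).mem_nhds rfl
  obtain ⟨r, hr, h2⟩ := Metric.mem_nhds_iff.1 h1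
  refine ⟨r, hr, fun l hl hlr => ?_⟩
  have : (⟨l, hl⟩ : Λ) ∈ ({0} : Set Λ) := h2 (by
    rw [Metric.mem_ball, dist_zero_right]
    exact hlr)
  exact congrArg Subtype.val this

lemma discreteTopology_of_forall_norm_lt_eq_zero {r : ℝ} (hr : 0 < r)
    (h : ∀ l ∈ Λ, ‖l‖ < r → l = 0) : DiscreteTopology Λ := by
  refine discreteTopology_of_isOpen_singleton_zero (Metric.isOpen_singleton_iff.2 ⟨r, hr, ?_⟩)
  intro l hl
  rw [dist_zero_right] at hl
  exact Subtype.ext (h l l.2 hl)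

/-- A continuous lift to `ℂⁿ` of a holomorphic self-map of a torus is affine: its differences
`z ↦ f (z + u) - f z` are holomorphic and periodic, hence constant by Liouville's theorem. -/
theorem exists_affine_of_lift [DiscreteTopology Λ] [IsZLattice ℝ Λ]
    {φ : CSpace n ⧸ Λ → CSpace n ⧸ Λ} (hφ : IsHolomorphicTorusMap Λ φ)
    {f : CSpace n → CSpace n} (hf : Continuous f) (hfφ : ∀ z, Λ.mkQ (f z) = φ (Λ.mkQ z)) :
    ∃ A : Module.End ℂ (CSpace n), ∀ z, f z = A z + f 0 := by
  have hdiff : Differentiable ℂ f := by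
    intro z
    obtain ⟨g, hg⟩ := hφ z
    obtain ⟨r, hr, hball⟩ := Metric.eventually_nhds_iff_ball.1 hg
    have hmem : ∀ w ∈ Metric.ball z r, f w - g w ∈ Λ := fun w hw => by
      rw [← Submodule.Quotient.eq]
      exact (hfφ w).trans (hball w hw).2.symm
    have : PreconnectedSpace (Metric.ball z r) :=
      Subtype.preconnectedSpace (convex_ball z r).isPreconnected
    have hgc : Continuous fun w : Metric.ball z r => g w := by
      rw [continuous_iff_continuousAt]
      intro w
      exact ((hball w w.2).1.continuousAt).comp continuous_subtype_val.continuousAt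
    have heq : ∀ w ∈ Metric.ball z r, f w = g w + (f z - g z) := fun w hw => by
      have := eq_of_continuous_of_sub_mem (hf.comp continuous_subtype_val) hgc
        (fun w : Metric.ball z r => hmem w w.2) ⟨w, hw⟩ ⟨z, Metric.mem_ball_self hr⟩
      simp only [Function.comp_apply] at this
      rw [← this]; abel
    have h1 : DifferentiableAt ℂ (fun w => g w + (f z - g z)) z :=
      ((hball z (Metric.mem_ball_self hr)).1).add_const _
    refine h1.congr_of_eventuallyEq ?_
    filter_upwards [Metric.ball_mem_nhds z hr] with w hw using heq w hw
  have hper : ∀ l ∈ Λ, ∀ z w, f (z + l) - f z = f (w + l) - f w := by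
    intro l hl z w
    refine eq_of_continuous_of_sub_mem (Λ := Λ) (by fun_prop : Continuous fun z => f (z + l)) hf
      (fun y => ?_) z w
    rw [← Submodule.Quotient.eq]
    refine (hfφ _).trans (Eq.trans ?_ (hfφ _).symm)
    rw [map_add, show Λ.mkQ l = 0 from (Submodule.Quotient.mk_eq_zero Λ).2 hl, add_zero]
  have hadd : ∀ u z, f (z + u) - f z = f u - f 0 := by
    intro u z
    have hd : Differentiable ℂ fun z => f (z + u) - f z := by fun_prop
    have hb : IsCompact (Set.range fun z => f (z + u) - f z) := by
      refine IsZLattice.isCompact_range_of_periodic Λ _ (by fun_prop) fun z l hl => ?_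
      have h1 := hper l hl (z + u) z
      rw [add_right_comm z l u]
      rw [sub_eq_sub_iff_sub_eq_sub] at h1
      exact h1
    have h2 := hd.apply_eq_apply_of_bounded hb.isBounded z 0
    simpa using h2
  let a : CSpace n →+ CSpace n :=
    { toFun := fun z => f z - f 0
      map_zero' := sub_self _
      map_add' := fun z u => by
        have := hadd u z
        rw [sub_eq_iff_eq_add] at this
        rw [this]; abel }
  let aR : CSpace n →L[ℝ] CSpace n := a.toRealLinearMap (by
    change Continuous fun z => f z - f 0
    fun_prop)
  have h1 : HasFDerivAt (fun z => f z - f 0) (fderiv ℂ f 0) 0 :=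
    (hdiff 0).hasFDerivAt.sub_const _
  have h2 : (fderiv ℂ f 0).restrictScalars ℝ = aR :=
    (h1.restrictScalars ℝ).unique (aR.hasFDerivAt)
  refine ⟨(fderiv ℂ f 0).toLinearMap, fun z => ?_⟩
  have h3 : (fderiv ℂ f 0) z = f z - f 0 := DFunLike.congr_fun h2 z
  rw [ContinuousLinearMap.coe_coe, h3, sub_add_cancel]

end Torus

/-! ### The fundamental group of a compact flat Kähler manifold -/

section FundamentalGroup

variable {n : ℕ} (X : FlatKahlerManifold n)

lemma FlatKahlerManifold.continuous_smul (g : X.F) : Continuous fun y : CSpace n ⧸ X.Λ => g • y := by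
  rw [X.Λ.isQuotientMap_mkQ.continuous_iff, continuous_iff_continuousAt]
  intro z
  obtain ⟨f, hf⟩ := X.holomorphic g z
  have h1 : ContinuousAt (fun w => X.Λ.mkQ (f w)) z :=
    X.Λ.isQuotientMap_mkQ.continuous.continuousAt.comp hf.self_of_nhds.1.continuousAt
  refine h1.congr ?_
  filter_upwards [hf] with w hw using hw.2

/-- If a group `Γ` acts on `ℂⁿ` by lifts of the elements of `X.F`, and if its elements lifting the
identity are exactly the translations by the lattice, then `ℂⁿ` is the universal covering of `X`
with group `Γ`. -/
theorem nonempty_mulEquiv_fundamentalGroup (x : X.Carrier) (Γ : Type*) [Group Γ]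
    [MulAction Γ (CSpace n)] [ContinuousConstSMul Γ (CSpace n)] (q : Γ → X.F)
    (hq : ∀ γ z, X.Λ.mkQ (γ • z) = q γ • X.Λ.mkQ z) (hqs : Function.Surjective q)
    (htrans : ∀ l ∈ X.Λ, ∃ γ : Γ, ∀ z : CSpace n, γ • z = z + l)
    (hker : ∀ γ, q γ = 1 → ∃ l ∈ X.Λ, ∀ z : CSpace n, γ • z = z + l)
    (hfaith : ∀ γ : Γ, (∀ z : CSpace n, γ • z = z) → γ = 1) :
    Nonempty (Γ ≃* FundamentalGroup X.Carrier x) := by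
  let pr : CSpace n → X.Carrier := fun z => Quotient.mk _ (X.Λ.mkQ z)
  have hpr : Topology.IsQuotientMap pr :=
    (isQuotientMap_quotient_mk' (s := MulAction.orbitRel X.F (CSpace n ⧸ X.Λ))).comp
      X.Λ.isQuotientMap_mkQ
  have hclosed : IsClosed (X.Λ : Set (CSpace n)) := by
    have : DiscreteTopology X.Λ.toAddSubgroup := inferInstanceAs (DiscreteTopology X.Λ)
    exact AddSubgroup.isClosed_of_discrete (H := X.Λ.toAddSubgroup)
  have hcov : IsQuotientCoveringMap pr Γ := by
    refine { toIsQuotientMap := hpr, toContinuousConstSMul := inferInstance,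
             apply_eq_iff_mem_orbit := ?_, disjoint := ?_ }
    · intro z w
      constructor
      · intro h
        obtain ⟨g, hg⟩ := Quotient.exact h
        obtain ⟨γ, rfl⟩ := hqs g
        have h1 : X.Λ.mkQ z = X.Λ.mkQ (γ • w) := by rw [hq]; exact hg.symm
        obtain ⟨δ, hδ⟩ := htrans _ ((Submodule.Quotient.eq X.Λ).1 h1)
        refine ⟨δ * γ, ?_⟩
        change (δ * γ) • w = z
        rw [mul_smul, hδ, add_sub_cancel]
      · rintro ⟨γ, rfl⟩
        exact Quotient.sound ⟨q γ, (hq γ w).symm⟩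
    · intro z
      have hV : ∀ g : X.F, ∃ V ∈ 𝓝 (X.Λ.mkQ z), g ≠ 1 → ∀ y ∈ V, g • y ∉ V := by
        intro g
        by_cases hg : g = 1
        · exact ⟨Set.univ, Filter.univ_mem, fun h => absurd hg h⟩
        · have hne : g • X.Λ.mkQ z ≠ X.Λ.mkQ z := fun h => hg (X.free g _ h)
          obtain ⟨U, W, hU, hW, hUm, hWm, hUW⟩ := t2_separation hne
          refine ⟨W ∩ (fun y => g • y) ⁻¹' U, Filter.inter_mem (hW.mem_nhds hWm)
            ((hU.preimage (X.continuous_smul g)).mem_nhds hUm), fun _ y hy hy' => ?_⟩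
          exact Set.disjoint_left.1 hUW hy.2 hy'.1
      choose V hV hVd using hV
      have hV' : (⋂ g, V g) ∈ 𝓝 (X.Λ.mkQ z) := Filter.iInter_mem.2 hV
      obtain ⟨r, hr, hΛ⟩ := exists_pos_forall_norm_lt_eq_zero X.Λ
      refine ⟨X.Λ.mkQ ⁻¹' (⋂ g, V g) ∩ Metric.ball z (r / 2),
        Filter.inter_mem (X.Λ.isQuotientMap_mkQ.continuous.continuousAt hV')
          (Metric.ball_mem_nhds z (half_pos hr)), ?_⟩
      rintro γ ⟨_, ⟨w, ⟨hwV, hwz⟩, rfl⟩, hγV, hγz⟩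
      have hγ1 : q γ = 1 := by
        by_contra hne
        refine hVd (q γ) hne (X.Λ.mkQ w) (Set.mem_iInter.1 hwV _) ?_
        rw [← hq]
        exact Set.mem_iInter.1 hγV _
      obtain ⟨l, hl, hγl⟩ := hker γ hγ1
      have hl0 : l = 0 := by
        refine hΛ l hl ?_
        have h1 : l = γ • w - w := by rw [hγl, add_sub_cancel_left]
        rw [h1, ← dist_eq_norm]
        calc dist (γ • w) w ≤ dist (γ • w) z + dist w z := dist_triangle_right _ _ _
          _ < r / 2 + r / 2 := add_lt_add hγz hwz
          _ = r := add_halves r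
      exact hfaith γ fun y => by rw [hγl, hl0, add_zero]
  obtain ⟨z, hz⟩ := hpr.surjective x
  have : ContractibleSpace (CSpace n) := RealTopologicalVectorSpace.contractibleSpace
  exact ⟨(MulEquiv.inv' Γ).trans (hcov.fundamentalGroupEquiv ⟨z, hz⟩).symm⟩

end FundamentalGroup

/-! ### Aspherical Kähler groups as crystallographic groups -/

section Crystallographic

/-- A complex crystallographic action of the group `Γ` on `ℂⁿ`: a free action by complex affine
maps `z ↦ lin γ z + trans γ` for which some normal subgroup of finite index acts as a full lattice
of translations. -/
structure ComplexCrystallographicAction (Γ : Type*) [Group Γ] (n : ℕ) where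
  /-- the linear part -/
  lin : Γ →* Module.End ℂ (CSpace n)
  /-- the translation part -/
  trans : Γ → CSpace n
  trans_mul : ∀ γ δ, trans (γ * δ) = trans γ + lin γ (trans δ)
  free : ∀ γ z, lin γ z + trans γ = z → γ = 1
  /-- a normal subgroup of finite index acting by translations -/
  K : Subgroup Γ
  normal : K.Normal
  finiteIndex : K.FiniteIndex
  /-- the lattice of translations in the subgroup `K` -/
  Λ : Submodule ℤ (CSpace n)
  discrete : DiscreteTopology Λ
  isZLattice : IsZLattice ℝ Λ
  lin_eq_one : ∀ γ ∈ K, lin γ = 1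
  mem_lattice_iff : ∀ l, l ∈ Λ ↔ ∃ γ ∈ K, trans γ = l

namespace ComplexCrystallographicAction

variable {Γ : Type*} [Group Γ] {n : ℕ} (S : ComplexCrystallographicAction Γ n)

lemma trans_one : S.trans 1 = 0 := by
  have := S.trans_mul 1 1
  rw [mul_one, map_one, Module.End.one_apply] at this
  exact left_eq_add.1 this

lemma trans_inv (γ : Γ) : S.lin γ (S.trans γ⁻¹) = -S.trans γ := by
  have := S.trans_mul γ γ⁻¹
  rw [mul_inv_cancel, S.trans_one] at this
  exact (neg_eq_of_add_eq_zero_right this.symm).symm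

/-- Transport of a complex crystallographic action along an isomorphism. -/
def congr {Γ' : Type*} [Group Γ'] (e : Γ' ≃* Γ) : ComplexCrystallographicAction Γ' n where
  lin := S.lin.comp e.toMonoidHom
  trans γ := S.trans (e γ)
  trans_mul γ δ := by rw [map_mul, S.trans_mul]; rfl
  free γ z h := e.injective (by rw [map_one]; exact S.free _ z h)
  K := S.K.comap e.toMonoidHom
  normal := S.normal.comap _
  finiteIndex := by
    have := S.finiteIndex
    exact ⟨by
      rw [Subgroup.index_comap_of_surjective _ e.surjective]
      exact this.index_ne_zero⟩
  Λ := S.Λ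
  discrete := S.discrete
  isZLattice := S.isZLattice
  lin_eq_one γ h := S.lin_eq_one _ h
  mem_lattice_iff l := by
    rw [S.mem_lattice_iff]
    exact ⟨fun ⟨γ, h, h'⟩ => ⟨e.symm γ, by simpa using h, by simpa using h'⟩,
      fun ⟨γ, h, h'⟩ => ⟨e γ, h, h'⟩⟩

/-- The action on `ℂⁿ` by affine maps. -/
@[reducible]
def mulAction : MulAction Γ (CSpace n) where
  smul γ z := S.lin γ z + S.trans γ
  one_smul z := by
    change S.lin 1 z + S.trans 1 = z
    rw [map_one, S.trans_one, add_zero, Module.End.one_apply]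
  mul_smul γ δ z := by
    change S.lin (γ * δ) z + S.trans (γ * δ) = S.lin γ (S.lin δ z + S.trans δ) + S.trans γ
    rw [map_mul, S.trans_mul, Module.End.mul_apply, map_add]
    abel

lemma lin_mem {l : CSpace n} (hl : l ∈ S.Λ) (γ : Γ) : S.lin γ l ∈ S.Λ := by
  obtain ⟨δ, hδ, rfl⟩ := (S.mem_lattice_iff l).1 hl
  refine (S.mem_lattice_iff _).2 ⟨γ * δ * γ⁻¹, S.normal.conj_mem δ hδ γ, ?_⟩
  rw [S.trans_mul, S.trans_mul, map_mul, S.lin_eq_one δ hδ, mul_one, S.trans_inv]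
  abel

/-- As the action is free, an element of `Γ` with a fixed point in the torus `ℂⁿ ⧸ Λ` belongs to `K`.
-/
lemma mem_K_of_lift {γ : Γ} {z : CSpace n} (h : S.lin γ z + S.trans γ - z ∈ S.Λ) : γ ∈ S.K := by
  obtain ⟨δ, hδ, h1⟩ := (S.mem_lattice_iff _).1 h
  have h2 : δ⁻¹ * γ = 1 := by
    refine S.free _ z ?_
    have h3 := @inv_smul_smul _ _ _ S.mulAction δ z
    have h4 : @HSMul.hSMul _ _ _ (@instHSMul _ _ S.mulAction.toSMul) δ z =
        S.lin γ z + S.trans γ := by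
      change S.lin δ z + S.trans δ = _
      rw [S.lin_eq_one δ hδ, h1, Module.End.one_apply, add_sub_cancel]
    rw [h4] at h3
    have h5 : S.lin (δ⁻¹ * γ) z + S.trans (δ⁻¹ * γ) =
        S.lin δ⁻¹ (S.lin γ z + S.trans γ) + S.trans δ⁻¹ :=
      @SemigroupAction.mul_smul _ _ _ S.mulAction.toSemigroupAction δ⁻¹ γ z
    exact h5.trans h3
  rw [inv_mul_eq_one] at h2
  rwa [← h2]

/-- The action on the torus `ℂⁿ ⧸ Λ` induced by a complex crystallographic action. -/
def torusHom : Γ →* Equiv.Perm (CSpace n ⧸ S.Λ) :=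
  letI : MulAction Γ (CSpace n ⧸ S.Λ) :=
    { smul := fun γ => Quotient.map' (fun z => S.lin γ z + S.trans γ) (by
        intro z w h
        have h1 : S.lin γ z + S.trans γ - (S.lin γ w + S.trans γ) = S.lin γ (z - w) := by
          rw [map_sub]; abel
        refine (Submodule.quotientRel_def S.Λ).2 ?_
        rw [h1]
        exact S.lin_mem ((Submodule.quotientRel_def S.Λ).1 h) γ)
      one_smul := fun y => by
        induction y using Quotient.inductionOn' with | h z =>
        exact congrArg _ (S.mulAction.one_smul z)
      mul_smul := fun γ δ y => by
        induction y using Quotient.inductionOn' with | h z =>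
        exact congrArg _ (S.mulAction.mul_smul γ δ z) }
  MulAction.toPermHom Γ _

lemma torusHom_mkQ (γ : Γ) (z : CSpace n) :
    S.torusHom γ (S.Λ.mkQ z) = S.Λ.mkQ (S.lin γ z + S.trans γ) := rfl

lemma torusHom_eq_one {γ : Γ} (hγ : γ ∈ S.K) : S.torusHom γ = 1 := by
  ext y
  obtain ⟨z, rfl⟩ := S.Λ.mkQ_surjective y
  rw [torusHom_mkQ, S.lin_eq_one γ hγ, Module.End.one_apply, map_add, Equiv.Perm.one_apply,
    show S.Λ.mkQ (S.trans γ) = 0 from (Submodule.Quotient.mk_eq_zero _).2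
      ((S.mem_lattice_iff _).2 ⟨γ, hγ, rfl⟩), add_zero]

/-- The compact flat Kähler manifold `(ℂⁿ ⧸ Λ) / (Γ ⧸ K)` of a complex crystallographic action. -/
def manifold {Γ : Type} [Group Γ] {n : ℕ} (S : ComplexCrystallographicAction Γ n) :
    FlatKahlerManifold n :=
  letI := S.discrete
  letI := S.isZLattice
  letI := S.normal
  letI := S.finiteIndex
  letI : MulAction (Γ ⧸ S.K) (CSpace n ⧸ S.Λ) :=
    MulAction.compHom _ (QuotientGroup.lift S.K S.torusHom fun _ h => S.torusHom_eq_one h)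
  { Λ := S.Λ
    F := Γ ⧸ S.K
    holomorphic := by
      intro g z
      obtain ⟨γ, rfl⟩ := QuotientGroup.mk_surjective g
      refine ⟨fun w => (LinearMap.toContinuousLinearMap (S.lin γ)) w + S.trans γ,
        Filter.Eventually.of_forall fun w => ⟨by fun_prop, rfl⟩⟩
    free := by
      intro g y hy
      obtain ⟨γ, rfl⟩ := QuotientGroup.mk_surjective g
      obtain ⟨z, rfl⟩ := S.Λ.mkQ_surjective y
      exact (QuotientGroup.eq_one_iff γ).2
        (S.mem_K_of_lift ((Submodule.Quotient.eq S.Λ).1 hy)) }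

/-- A group with a complex crystallographic action is an aspherical Kähler group. -/
theorem isAsphericalKahlerGroup {Γ : Type} [Group Γ] {n : ℕ}
    (S : ComplexCrystallographicAction Γ n) : IsAsphericalKahlerGroup Γ n := by
  let := S.normal
  let : MulAction Γ (CSpace n) := S.mulAction
  have hcont : ContinuousConstSMul Γ (CSpace n) :=
    ⟨fun γ => (LinearMap.toContinuousLinearMap (S.lin γ)).continuous.add continuous_const⟩
  refine ⟨S.manifold, Quotient.mk _ (S.Λ.mkQ 0), nonempty_mulEquiv_fundamentalGroup S.manifold _ Γ
    (QuotientGroup.mk (s := S.K)) (fun γ z => rfl) QuotientGroup.mk_surjective ?_ ?_ ?_⟩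
  · intro l hl
    obtain ⟨γ, hγ, rfl⟩ := (S.mem_lattice_iff l).1 hl
    refine ⟨γ, fun z => ?_⟩
    change S.lin γ z + S.trans γ = _
    rw [S.lin_eq_one γ hγ, Module.End.one_apply]
  · intro γ hγ
    have hγK : γ ∈ S.K := (QuotientGroup.eq_one_iff γ).1 hγ
    refine ⟨S.trans γ, (S.mem_lattice_iff _).2 ⟨γ, hγK, rfl⟩, fun z => ?_⟩
    change S.lin γ z + S.trans γ = _
    rw [S.lin_eq_one γ hγK, Module.End.one_apply]
  · intro γ hγ
    exact S.free γ 0 (hγ 0)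

end ComplexCrystallographicAction

namespace FlatKahlerManifold

variable {n : ℕ} (X : FlatKahlerManifold n)

/-- The group of all homeomorphisms of `ℂⁿ` that lift elements of `X.F`. -/
def liftGroup : Subgroup (CSpace n ≃ₜ CSpace n) where
  carrier := {f | ∃ g : X.F, ∀ z, X.Λ.mkQ (f z) = g • X.Λ.mkQ z}
  mul_mem' := by
    rintro f f' ⟨g, hg⟩ ⟨g', hg'⟩
    refine ⟨g * g', fun z => ?_⟩
    rw [mul_smul, ← hg', ← hg]
    rfl
  one_mem' := ⟨1, fun z => by rw [one_smul]; rfl⟩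
  inv_mem' := by
    rintro f ⟨g, hg⟩
    refine ⟨g⁻¹, fun z => ?_⟩
    rw [eq_inv_smul_iff, ← hg]
    exact congrArg _ (f.apply_symm_apply z)

lemma eq_id_of_lift {f : CSpace n → CSpace n} (hf : Continuous f)
    (h : ∀ z, X.Λ.mkQ (f z) = X.Λ.mkQ z) (z₀ : CSpace n) (h0 : f z₀ = z₀) (z : CSpace n) :
    f z = z := by
  have := eq_of_continuous_of_sub_mem (Λ := X.Λ) hf continuous_id
    (fun y => (Submodule.Quotient.eq X.Λ).1 (h y)) z z₀
  rw [h0, id, id, sub_self] at this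
  exact sub_eq_zero.1 this

lemma exists_lift (g : X.F) :
    ∃ f : CSpace n ≃ₜ CSpace n, ∀ z, X.Λ.mkQ (f z) = g • X.Λ.mkQ z := by
  have : ContractibleSpace (CSpace n) := RealTopologicalVectorSpace.contractibleSpace
  have key : ∀ (g : X.F) (z w : CSpace n), X.Λ.mkQ w = g • X.Λ.mkQ z →
      ∃ f : C(CSpace n, CSpace n), f z = w ∧ ∀ y, X.Λ.mkQ (f y) = g • X.Λ.mkQ y := by
    intro g z w h
    obtain ⟨f, ⟨h1, h2⟩, -⟩ := (isCoveringMap_mkQ (Λ := X.Λ)).existsUnique_continuousMap_lifts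
      ⟨fun y => g • X.Λ.mkQ y, (X.continuous_smul g).comp X.Λ.isQuotientMap_mkQ.continuous⟩ z w h
    exact ⟨f, h1, congrFun h2⟩
  obtain ⟨w, hw⟩ := X.Λ.mkQ_surjective (g • X.Λ.mkQ 0)
  obtain ⟨f, hf0, hf⟩ := key g 0 w hw
  obtain ⟨f', hf'0, hf'⟩ := key g⁻¹ w 0 (by rw [hw, inv_smul_smul])
  refine ⟨{ toFun := f, invFun := f', left_inv := fun z => ?_, right_inv := fun z => ?_ }, hf⟩
  · exact X.eq_id_of_lift (f'.continuous.comp f.continuous)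
      (fun y => by rw [Function.comp_apply, hf', hf, inv_smul_smul]) 0
      (by rw [Function.comp_apply, hf0, hf'0]) z
  · exact X.eq_id_of_lift (f.continuous.comp f'.continuous)
      (fun y => by rw [Function.comp_apply, hf, hf', smul_inv_smul]) w
      (by rw [Function.comp_apply, hf'0, hf0]) z

/-- The homomorphism sending a lift to the element of `X.F` that it lifts. -/
def liftGroupHom : X.liftGroup →* X.F where
  toFun f := f.2.choose
  map_one' := by
    refine X.free _ (X.Λ.mkQ 0) ?_
    exact ((1 : X.liftGroup).2.choose_spec 0).symm
  map_mul' f f' := by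
    have h1 := (f * f').2.choose_spec 0
    have h2 : (f * f').2.choose • X.Λ.mkQ 0 = (f.2.choose * f'.2.choose) • X.Λ.mkQ 0 := by
      rw [mul_smul, ← h1, ← f'.2.choose_spec, ← f.2.choose_spec]
      rfl
    have h3 : ((f.2.choose * f'.2.choose)⁻¹ * (f * f').2.choose) • X.Λ.mkQ 0 = X.Λ.mkQ 0 := by
      rw [mul_smul, h2, inv_smul_smul]
    exact (inv_mul_eq_one.1 (X.free _ _ h3)).symm

lemma mkQ_liftGroup (f : X.liftGroup) (z : CSpace n) :
    X.Λ.mkQ ((f : CSpace n ≃ₜ CSpace n) z) = X.liftGroupHom f • X.Λ.mkQ z :=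
  f.2.choose_spec z

lemma liftGroupHom_surjective : Function.Surjective X.liftGroupHom := by
  intro g
  obtain ⟨f, hf⟩ := X.exists_lift g
  refine ⟨⟨f, g, hf⟩, ?_⟩
  have h1 := (X.mkQ_liftGroup ⟨f, g, hf⟩ 0).symm.trans (hf 0)
  have h2 : (g⁻¹ * X.liftGroupHom ⟨f, g, hf⟩) • X.Λ.mkQ 0 = X.Λ.mkQ 0 := by
    rw [mul_smul, h1, inv_smul_smul]
  exact (inv_mul_eq_one.1 (X.free _ _ h2)).symm

lemma exists_translation_of_liftGroupHom_eq_one {f : X.liftGroup} (hf : X.liftGroupHom f = 1) :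
    ∃ l ∈ X.Λ, ∀ z, (f : CSpace n ≃ₜ CSpace n) z = z + l := by
  have h1 : ∀ z, (f : CSpace n ≃ₜ CSpace n) z - z ∈ X.Λ := fun z => by
    rw [← Submodule.Quotient.eq]
    refine (X.mkQ_liftGroup f z).trans ?_
    rw [hf, one_smul]
    rfl
  refine ⟨_, h1 0, fun z => ?_⟩
  have := eq_of_continuous_of_sub_mem (f : CSpace n ≃ₜ CSpace n).continuous continuous_id h1 z 0
  exact eq_add_of_sub_eq' this

lemma exists_mem_liftGroup_translation {l : CSpace n} (hl : l ∈ X.Λ) :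
    ∃ f : X.liftGroup, X.liftGroupHom f = 1 ∧ ∀ z, (f : CSpace n ≃ₜ CSpace n) z = z + l := by
  have h0 : ∀ z, X.Λ.mkQ (z + l) = X.Λ.mkQ z := fun z => by
    rw [map_add, show X.Λ.mkQ l = 0 from (Submodule.Quotient.mk_eq_zero X.Λ).2 hl, add_zero]
  have h : Homeomorph.addRight l ∈ X.liftGroup := ⟨1, fun z => by rw [one_smul]; exact h0 z⟩
  refine ⟨⟨_, h⟩, X.free _ (X.Λ.mkQ 0) ?_, fun z => rfl⟩
  rw [← mkQ_liftGroup]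
  exact h0 0

/-- The group of lifts acts on `ℂⁿ` by affine maps, freely and with a lattice of translations. -/
theorem nonempty_action_liftGroup : Nonempty (ComplexCrystallographicAction X.liftGroup n) := by
  have haff : ∀ f : X.liftGroup, ∃ A : Module.End ℂ (CSpace n),
      ∀ z, (f : CSpace n ≃ₜ CSpace n) z = A z + (f : CSpace n ≃ₜ CSpace n) 0 := fun f =>
    exists_affine_of_lift (X.holomorphic (X.liftGroupHom f)) f.1.continuous
      fun z => X.mkQ_liftGroup f z
  choose A hA using haff
  have hA' : ∀ f z, A f z = (f : CSpace n ≃ₜ CSpace n) z - (f : CSpace n ≃ₜ CSpace n) 0 :=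
    fun f z => eq_sub_of_add_eq (hA f z).symm
  have hmul : ∀ (f f' : X.liftGroup) z, ((f * f' : X.liftGroup) : CSpace n ≃ₜ CSpace n) z =
      (f : CSpace n ≃ₜ CSpace n) ((f' : CSpace n ≃ₜ CSpace n) z) := fun f f' z => rfl
  have hone : ∀ z, ((1 : X.liftGroup) : CSpace n ≃ₜ CSpace n) z = z := fun z => rfl
  have hK : ∀ f ∈ X.liftGroupHom.ker, ∃ l ∈ X.Λ, ∀ z, (f : CSpace n ≃ₜ CSpace n) z = z + l :=
    fun f hf => X.exists_translation_of_liftGroupHom_eq_one hf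
  exact ⟨{
    lin :=
      { toFun := A
        map_one' := by
          ext1 z
          rw [hA', hone, hone, sub_zero, Module.End.one_apply]
        map_mul' := fun f f' => by
          ext1 z
          rw [hA', hmul, hmul, hA f, hA f ((f' : CSpace n ≃ₜ CSpace n) 0), Module.End.mul_apply,
            hA' f' z, map_sub]
          abel }
    trans := fun f => (f : CSpace n ≃ₜ CSpace n) 0
    trans_mul := fun f f' => by
      change _ = _ + A f _
      rw [hmul, hA f, add_comm]
    free := fun f z hz => by
      have hfz : (f : CSpace n ≃ₜ CSpace n) z = z := (hA f z).trans hz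
      have h1 : X.liftGroupHom f = 1 := X.free _ (X.Λ.mkQ z) (by rw [← mkQ_liftGroup, hfz])
      obtain ⟨l, -, hl⟩ := X.exists_translation_of_liftGroupHom_eq_one h1
      have h2 : l = 0 := by
        have := hl z
        rw [hfz] at this
        exact left_eq_add.1 this
      apply Subtype.ext
      ext1 w
      rw [hl, h2, add_zero]
      rfl
    K := X.liftGroupHom.ker
    normal := inferInstance
    finiteIndex := inferInstance
    Λ := X.Λ
    discrete := X.discrete
    isZLattice := X.isZLattice
    lin_eq_one := fun f hf => by
      obtain ⟨l, -, hl⟩ := hK f hf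
      ext1 z
      change A f z = z
      rw [hA', hl, hl, zero_add, add_sub_cancel_right]
    mem_lattice_iff := fun l => by
      constructor
      · intro h
        obtain ⟨f, h1, h2⟩ := X.exists_mem_liftGroup_translation h
        exact ⟨f, h1, (h2 0).trans (zero_add l)⟩
      · rintro ⟨f, hf, rfl⟩
        obtain ⟨l, hl, h⟩ := hK f hf
        rw [h 0, zero_add]
        exact hl }⟩

end FlatKahlerManifold

/-- An aspherical Kähler group has a complex crystallographic action. -/
theorem IsAsphericalKahlerGroup.nonempty_action {Γ : Type} [Group Γ] {n : ℕ}
    (h : IsAsphericalKahlerGroup Γ n) : Nonempty (ComplexCrystallographicAction Γ n) := by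
  obtain ⟨X, x, ⟨e⟩⟩ := h
  obtain ⟨S⟩ := X.nonempty_action_liftGroup
  let : MulAction X.liftGroup (CSpace n) :=
    { smul := fun f z => (f : CSpace n ≃ₜ CSpace n) z
      one_smul := fun z => rfl
      mul_smul := fun f f' z => rfl }
  have : ContinuousConstSMul X.liftGroup (CSpace n) :=
    ⟨fun f => (f : CSpace n ≃ₜ CSpace n).continuous⟩
  obtain ⟨e'⟩ := nonempty_mulEquiv_fundamentalGroup X x X.liftGroup X.liftGroupHom
    X.mkQ_liftGroup X.liftGroupHom_surjective
    (fun l hl => (X.exists_mem_liftGroup_translation hl).imp fun f hf => hf.2)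
    (fun f hf => X.exists_translation_of_liftGroupHom_eq_one hf)
    (fun f hf => Subtype.ext (Homeomorph.ext hf))
  exact ⟨S.congr (e.trans e'.symm)⟩

end Crystallographic

/-! ### Quotients of a complex lattice representation -/

section ComplexQuotient

open TensorProduct

/-- A real representation with an invariant complex structure `J` is isomorphic to a complex
representation on some `ℂᵐ`. -/
lemma exists_equiv_CSpace {G W : Type*} [Group G] [AddCommGroup W] [Module ℝ W]
    [Module.Finite ℝ W] (J : W →ₗ[ℝ] W) (hJ : ∀ w, J (J w) = -w) (T : G →* Module.End ℝ W)
    (hT : ∀ g w, T g (J w) = J (T g w)) :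
    ∃ (m : ℕ) (θ : W ≃ₗ[ℝ] CSpace m) (lin : G →* Module.End ℂ (CSpace m)),
      Module.finrank ℝ W = 2 * m ∧ ∀ g w, θ (T g w) = lin g (θ w) := by
  have hJ' : J * J = -1 := by
    ext w
    exact hJ w
  let φ : ℂ →ₐ[ℝ] Module.End ℝ W := Complex.lift ⟨J, hJ'⟩
  let _ : Module ℂ W := Module.compHom W φ.toRingHom
  have hsmul : ∀ (c : ℂ) (w : W), c • w = φ c w := fun c w => rfl
  have hφ : ∀ (c : ℂ) (w : W), φ c w = c.re • w + c.im • J w := fun c w => by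
    simp [φ, Complex.liftAux_apply, Module.algebraMap_end_apply]
  have : IsScalarTower ℝ ℂ W := ⟨fun r c w => by
    rw [hsmul, hsmul, map_smul, LinearMap.smul_apply]⟩
  have : Module.Finite ℂ W := Module.Finite.of_restrictScalars_finite ℝ ℂ W
  let θ : W ≃ₗ[ℂ] CSpace (Module.finrank ℂ W) :=
    (Module.finBasis ℂ W).equivFun.trans (WithLp.linearEquiv 2 ℂ (Fin _ → ℂ)).symm
  let T' : G → Module.End ℂ W := fun g =>
    { toFun := T g
      map_add' := map_add _
      map_smul' := fun c w => by
        rw [RingHom.id_apply, hsmul, hsmul, hφ, hφ, map_add, map_smul, map_smul, hT] }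
  let lin : G →* Module.End ℂ (CSpace (Module.finrank ℂ W)) :=
    { toFun := fun g => θ.conj (T' g)
      map_one' := by
        have : T' 1 = LinearMap.id := by
          ext1 w
          change T 1 w = w
          rw [map_one, Module.End.one_apply]
        rw [this, LinearEquiv.conj_id]
        rfl
      map_mul' := fun g h => by
        have : T' (g * h) = T' g ∘ₗ T' h := by
          ext1 w
          change T (g * h) w = T g (T h w)
          rw [map_mul, Module.End.mul_apply]
        rw [this, LinearEquiv.conj_comp]
        rfl }
  refine ⟨Module.finrank ℂ W, θ.restrictScalars ℝ, lin, ?_, fun g w => ?_⟩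
  · rw [← Module.finrank_mul_finrank ℝ ℂ W, Complex.finrank_real_complex]
  · change θ (T g w) = θ.conj (T' g) (θ w)
    rw [LinearEquiv.conj_apply_apply, LinearEquiv.symm_apply_apply]
    rfl

lemma realSMul_add_apply {R X : Type*} [Ring R] [Algebra ℚ R] [AddCommGroup X] [Module ℚ X]
    [Module R X] (r s : R) (z : ℝ ⊗[ℚ] X) :
    realSMul X (r + s) z = realSMul X r z + realSMul X s z := by
  induction z with
  | zero => simp
  | tmul a x => simp [add_smul, tmul_add]
  | add x y hx hy => simp only [map_add, hx, hy]; abel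

lemma realSMul_mul_apply {R X : Type*} [Ring R] [Algebra ℚ R] [AddCommGroup X] [Module ℚ X]
    [Module R X] (r s : R) (z : ℝ ⊗[ℚ] X) :
    realSMul X (r * s) z = realSMul X r (realSMul X s z) := by
  induction z with
  | zero => simp
  | tmul a x => simp [mul_smul]
  | add x y hx hy => simp only [map_add, hx, hy]

lemma realSMul_one_apply {R X : Type*} [Ring R] [Algebra ℚ R] [AddCommGroup X] [Module ℚ X]
    [Module R X] (z : ℝ ⊗[ℚ] X) : realSMul X (1 : R) z = z := by
  induction z with
  | zero => simp
  | tmul a x => simp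
  | add x y hx hy => simp only [map_add, hx, hy]

lemma realSMul_smul_apply {R X : Type*} [Ring R] [Algebra ℚ R] [AddCommGroup X] [Module ℚ X]
    [Module R X] (q : ℚ) (r : R) (z : ℝ ⊗[ℚ] X) :
    realSMul X (q • r) z = (q : ℝ) • realSMul X r z := by
  induction z with
  | zero => simp
  | tmul a x =>
    rw [realSMul_tmul, realSMul_tmul, smul_assoc, tmul_smul, smul_tmul', smul_tmul',
      Rat.smul_def, smul_eq_mul]
  | add x y hx hy => simp only [map_add, hx, hy, smul_add]

/-- A real-linear map commuting with a group commutes with its rational group ring. -/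
lemma isRealEquivariant_of_forall_of {G X Y : Type*} [Group G]
    [AddCommGroup X] [Module ℚ X] [Module (MonoidAlgebra ℚ G) X]
    [AddCommGroup Y] [Module ℚ Y] [Module (MonoidAlgebra ℚ G) Y]
    (Φ : ℝ ⊗[ℚ] X →ₗ[ℝ] ℝ ⊗[ℚ] Y)
    (h : ∀ g z, Φ (realSMul X (MonoidAlgebra.of ℚ G g) z) =
      realSMul Y (MonoidAlgebra.of ℚ G g) (Φ z)) : IsRealEquivariant (MonoidAlgebra ℚ G) Φ := by
  intro r z
  induction r using MonoidAlgebra.induction_on with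
  | of g => exact h g z
  | add r s hr hs => rw [realSMul_add_apply, realSMul_add_apply, map_add, hr, hs]
  | smul q r hr => rw [realSMul_smul_apply, realSMul_smul_apply, map_smul, hr]

/-- A finitely generated subgroup spanning a rational vector space is spanned over `ℤ` by a
rational basis. -/
lemma exists_basis_span_int_eq_range {A V : Type*} [AddCommGroup A] [Module.Finite ℤ A]
    [AddCommGroup V] [Module ℚ V] (f : A →ₗ[ℤ] V)
    (hf : Submodule.span ℚ (Set.range f) = ⊤) :
    ∃ (ι : Type) (_ : Finite ι) (b : Module.Basis ι ℚ V),
      Submodule.span ℤ (Set.range b) = LinearMap.range f := by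
  have : IsAddTorsionFree V := .of_module_rat V
  have : Module.Free ℤ (LinearMap.range f) := inferInstance
  let d := Module.finBasis ℤ (LinearMap.range f)
  have hspan : Submodule.span ℤ (Set.range fun i => (d i : V)) = LinearMap.range f := by
    have h1 := congrArg (Submodule.map (LinearMap.range f).subtype) d.span_eq
    rw [Submodule.map_span, ← Set.range_comp, Submodule.map_top, Submodule.range_subtype] at h1
    exact h1
  have hli : LinearIndependent ℚ fun i => (d i : V) := by
    rw [← LinearIndependent.iff_fractionRing ℤ ℚ]
    exact d.linearIndependent.map' (LinearMap.range f).subtype (Submodule.ker_subtype _)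
  refine ⟨_, inferInstance, Module.Basis.mk hli ?_, ?_⟩
  · rw [← hf, Submodule.span_le]
    intro x hx
    have h2 : x ∈ Submodule.span ℤ (Set.range fun i => (d i : V)) := by
      rw [hspan]; exact hx
    exact Submodule.span_le_restrictScalars ℤ ℚ _ h2
  · rw [Module.Basis.coe_mk, hspan]

/-- The image in `ℝ ⊗ V ≃ ℂᵐ` of a finitely generated subgroup spanning the rational vector space
`V` is a full lattice. -/
lemma exists_lattice_real_extension {A V : Type*} [AddCommGroup A] [Module.Finite ℤ A]
    [AddCommGroup V] [Module ℚ V] (f : A →ₗ[ℤ] V)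
    (hf : Submodule.span ℚ (Set.range f) = ⊤) {m : ℕ} (θ : ℝ ⊗[ℚ] V ≃ₗ[ℝ] CSpace m) :
    ∃ (Λ : Submodule ℤ (CSpace m)) (_ : DiscreteTopology Λ), IsZLattice ℝ Λ ∧
      ∀ w, w ∈ Λ ↔ ∃ a, θ (1 ⊗ₜ f a) = w := by
  obtain ⟨ι, _, b, hb⟩ := exists_basis_span_int_eq_range f hf
  let b' : Module.Basis ι ℝ (CSpace m) := (b.baseChange ℝ).map θ
  have hb' : ∀ i, b' i = θ (1 ⊗ₜ b i) := fun i => by simp [b']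
  let η : V →+ CSpace m :=
    { toFun := fun y => θ (1 ⊗ₜ y)
      map_zero' := by rw [tmul_zero, map_zero]
      map_add' := fun y y' => by rw [tmul_add, map_add] }
  have hη : Submodule.span ℤ (Set.range b') =
      Submodule.map η.toIntLinearMap (LinearMap.range f) := by
    rw [← hb, Submodule.map_span, ← Set.range_comp]
    congr 2
    ext1 i
    exact hb' i
  refine ⟨Submodule.span ℤ (Set.range b'), inferInstance, inferInstance, fun w => ?_⟩
  rw [hη]
  constructor
  · rintro ⟨_, ⟨a, rfl⟩, rfl⟩
    exact ⟨a, rfl⟩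
  · rintro ⟨a, rfl⟩
    exact ⟨_, ⟨a, rfl⟩, rfl⟩

section Rationalization

variable {G A B : Type*} [Group G] [AddCommGroup A] [AddCommGroup B]

/-- The rational representation `ℚ ⊗ A` obtained from an integral representation `A`. -/
def Representation.rational (ρ : Representation ℤ G A) : Representation ℚ G (ℚ ⊗[ℤ] A) where
  toFun g := (ρ g).baseChange ℚ
  map_one' := by
    rw [map_one]
    exact LinearMap.baseChange_id
  map_mul' g h := by
    rw [map_mul]
    exact LinearMap.baseChange_comp _ _

/-- The map `a ↦ 1 ⊗ a` from an integral representation to its rationalization, considered as a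
module over the rational group ring. -/
def Representation.toRational (ρ : Representation ℤ G A) : A →ₗ[ℤ] ρ.rational.asModule :=
  TensorProduct.mk ℤ ℚ A 1

lemma Representation.toRational_apply (ρ : Representation ℤ G A) (g : G) (a : A) :
    ρ.toRational (ρ g a) = MonoidAlgebra.of ℚ G g • ρ.toRational a :=
  ρ.rational.asModuleEquiv_symm_map_rho g (1 ⊗ₜ a)

lemma Representation.span_range_toRational (ρ : Representation ℤ G A) :
    Submodule.span ℚ (Set.range ρ.toRational) = ⊤ := by
  rw [eq_top_iff]
  rintro (z : ℚ ⊗[ℤ] A) -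
  change z ∈ (Submodule.span ℚ (Set.range (TensorProduct.mk ℤ ℚ A 1)) : Submodule ℚ (ℚ ⊗[ℤ] A))
  induction z with
  | zero => exact Submodule.zero_mem _
  | tmul q a =>
    have : q ⊗ₜ[ℤ] a = q • ((1 : ℚ) ⊗ₜ[ℤ] a) := by rw [smul_tmul', smul_eq_mul, mul_one]
    rw [this]
    exact Submodule.smul_mem _ _ (Submodule.subset_span ⟨a, rfl⟩)
  | add x y hx hy => exact Submodule.add_mem _ hx hy

/-- Real-linear maps out of `ℝ ⊗ (ℚ ⊗ A)` are determined by their values on `A`. -/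
lemma Representation.real_rational_ext (ρ : Representation ℤ G A) {M : Type*} [AddCommGroup M]
    [Module ℝ M] {Φ Ψ : ℝ ⊗[ℚ] ρ.rational.asModule →ₗ[ℝ] M}
    (h : ∀ a, Φ (1 ⊗ₜ ρ.toRational a) = Ψ (1 ⊗ₜ ρ.toRational a)) : Φ = Ψ := by
  have h1 : ∀ v ∈ Submodule.span ℚ (Set.range ρ.toRational), Φ (1 ⊗ₜ v) = Ψ (1 ⊗ₜ v) := by
    intro v hv
    induction hv using Submodule.span_induction with
    | mem v hv =>
      obtain ⟨a, rfl⟩ := hv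
      exact h a
    | zero => rw [tmul_zero, map_zero, map_zero]
    | add v w _ _ hv hw => rw [tmul_add, map_add, map_add, hv, hw]
    | smul q v _ hv =>
      have : (1 : ℝ) ⊗ₜ[ℚ] (q • v) = (q : ℝ) • ((1 : ℝ) ⊗ₜ[ℚ] v) := by
        rw [tmul_smul, smul_tmul', smul_tmul', Rat.smul_def, smul_eq_mul]
      rw [this, map_smul, map_smul, hv]
  refine LinearMap.ext fun z => ?_
  induction z with
  | zero => rw [map_zero, map_zero]
  | tmul a v =>
    have hv : v ∈ Submodule.span ℚ (Set.range ρ.toRational) := by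
      rw [ρ.span_range_toRational]; trivial
    have : a ⊗ₜ[ℚ] v = a • ((1 : ℝ) ⊗ₜ[ℚ] v) := by rw [smul_tmul', smul_eq_mul, mul_one]
    rw [this, map_smul, map_smul, h1 v hv]
  | add x y hx hy => rw [map_add, map_add, hx, hy]

/-- The rationalization of an equivariant map. -/
def Representation.rationalMap (ρ : Representation ℤ G A) (ρ' : Representation ℤ G B)
    (f : A →ₗ[ℤ] B) (hf : ∀ g a, f (ρ g a) = ρ' g (f a)) :
    ρ.rational.asModule →ₗ[MonoidAlgebra ℚ G] ρ'.rational.asModule :=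
  MonoidAlgebra.equivariantOfLinearOfComm (R := ℚ) (V := ρ.rational.asModule)
    (W := ρ'.rational.asModule) (f.baseChange ℚ) (by
      intro g v
      have h1 : ∀ v : ℚ ⊗[ℤ] A, f.baseChange ℚ (ρ.rational g v) =
          ρ'.rational g (f.baseChange ℚ v) := by
        intro v
        induction v with
        | zero => simp
        | tmul q a =>
          change q ⊗ₜ[ℤ] f (ρ g a) = q ⊗ₜ[ℤ] ρ' g (f a)
          rw [hf]
        | add x y hx hy => simp only [map_add, hx, hy]
      have h2 := Representation.single_smul ρ.rational 1 g v
      have h3 := Representation.single_smul ρ'.rational 1 g (f.baseChange ℚ v)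
      rw [one_smul] at h2 h3
      exact (congrArg (f.baseChange ℚ) h2).trans ((h1 v).trans h3.symm))

/-- A pure invariant subgroup `N` of a lattice `A` with an action of `G` is the intersection of
`A` with a submodule of the rationalization of `A`, whose codimension is the rank of `A ⧸ N`. -/
lemma Representation.exists_submodule_rational [Module.Finite ℤ A] (ρ : Representation ℤ G A)
    (N : Submodule ℤ A) (hN : ∀ g, N ≤ N.comap (ρ g))
    (hpure : ∀ (m : ℤ) (a : A), m ≠ 0 → m • a ∈ N → a ∈ N) :
    ∃ NQ : Submodule (MonoidAlgebra ℚ G) ρ.rational.asModule,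
      Module.finrank ℚ (ρ.rational.asModule ⧸ NQ) = Module.finrank ℤ (A ⧸ N) ∧
      ∀ a, ρ.toRational a ∈ NQ → a ∈ N := by
  have : Module.IsTorsionFree ℤ (A ⧸ N) := by
    refine Module.IsTorsionFree.of_smul_eq_zero fun m y hy => ?_
    obtain ⟨a, rfl⟩ := N.mkQ_surjective y
    refine or_iff_not_imp_left.2 fun hm => ?_
    rw [← map_smul] at hy
    exact (Submodule.Quotient.mk_eq_zero N).2
      (hpure m a hm ((Submodule.Quotient.mk_eq_zero N).1 hy))
  let F := ρ.rationalMap (ρ.quotient N hN) N.mkQ (fun _ _ => rfl)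
  have hF : Function.Surjective F := LinearMap.lTensor_surjective ℚ N.mkQ_surjective
  refine ⟨LinearMap.ker F, ?_, fun a ha => ?_⟩
  · rw [((F.quotKerEquivOfSurjective hF).restrictScalars ℚ).finrank_eq]
    exact Module.finrank_baseChange (R := ℚ) (S := ℤ) (M' := A ⧸ N)
  · have h1 : (1 : ℚ) ⊗ₜ[ℤ] N.mkQ a = 0 := ha
    have h2 : N.mkQ a = 0 := by
      have hinj := Module.Flat.tensorProduct_mk_injective (R := ℤ) (S := ℚ) (M := A ⧸ N)
      refine hinj ?_
      rw [map_zero]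
      exact h1
    exact (Submodule.Quotient.mk_eq_zero N).1 h2

end Rationalization

/-- The real vector space spanned by a full lattice is its real scalar extension. -/
lemma exists_equiv_real_rational {G : Type*} [Group G] {n : ℕ} (Λ : Submodule ℤ (CSpace n))
    [DiscreteTopology Λ] [IsZLattice ℝ Λ] (ρ : Representation ℤ G Λ) :
    ∃ Ψ : ℝ ⊗[ℚ] ρ.rational.asModule ≃ₗ[ℝ] CSpace n,
      ∀ l : Λ, Ψ (1 ⊗ₜ ρ.toRational l) = l := by
  have := ZLattice.module_free ℝ Λ
  let b := Module.Free.chooseBasis ℤ Λ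
  let e1 : ℝ ⊗[ℤ] Λ ≃ₗ[ℝ] CSpace n :=
    (b.baseChange ℝ).equiv (b.ofZLatticeBasis ℝ Λ) (Equiv.refl _)
  have he1 : ∀ l : Λ, e1 (1 ⊗ₜ l) = l := by
    intro l
    have h : (e1.toLinearMap.restrictScalars ℤ) ∘ₗ TensorProduct.mk ℤ ℝ Λ 1 = Λ.subtype := by
      refine b.ext fun i => ?_
      have h2 : e1 (b.baseChange ℝ i) = b.ofZLatticeBasis ℝ Λ i :=
        Module.Basis.equiv_apply _ _ _ _
      rw [Module.Basis.baseChange_apply, Module.Basis.ofZLatticeBasis_apply] at h2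
      exact h2
    exact LinearMap.congr_fun h l
  let e2 : ℝ ⊗[ℚ] (ℚ ⊗[ℤ] Λ) ≃ₗ[ℝ] ℝ ⊗[ℤ] Λ :=
    TensorProduct.AlgebraTensorModule.cancelBaseChange ℤ ℚ ℝ ℝ Λ
  refine ⟨e2.trans e1, fun l => ?_⟩
  have h3 : e2 (1 ⊗ₜ ((1 : ℚ) ⊗ₜ l)) = 1 ⊗ₜ l := by
    rw [TensorProduct.AlgebraTensorModule.cancelBaseChange_tmul, one_smul]
  exact (congrArg e1 h3).trans (he1 l)

/-- Let `Λ` be a lattice in `ℂⁿ`, invariant under a group of complex linear maps. Every pure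
invariant subgroup `N` of `Λ` contains the kernel of an equivariant map from `Λ` onto a full
lattice in some complex representation `ℂᵐ`, where `m` is at most the rank of `Λ ⧸ N`. -/
theorem exists_complex_quotient {G : Type*} [Group G] [Finite G] {n : ℕ}
    (Λ : Submodule ℤ (CSpace n)) [DiscreteTopology Λ] [IsZLattice ℝ Λ]
    (lin : G →* Module.End ℂ (CSpace n)) (ρ : Representation ℤ G Λ)
    (hρ : ∀ g (l : Λ), (ρ g l : CSpace n) = lin g l)
    (N : Submodule ℤ Λ) (hN : ∀ g, N ≤ N.comap (ρ g))
    (hpure : ∀ (m : ℤ) (a : Λ), m ≠ 0 → m • a ∈ N → a ∈ N) :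
    ∃ (m : ℕ) (π : CSpace n →ₗ[ℝ] CSpace m) (lin' : G →* Module.End ℂ (CSpace m))
      (Λ' : Submodule ℤ (CSpace m)) (_ : DiscreteTopology Λ'), IsZLattice ℝ Λ' ∧
      m ≤ Module.finrank ℤ (Λ ⧸ N) ∧ (∀ g z, π (lin g z) = lin' g (π z)) ∧
      (∀ l : Λ, π l = 0 → l ∈ N) ∧ ∀ w, w ∈ Λ' ↔ ∃ l ∈ Λ, π l = w := by
  have : Module.Finite ℤ Λ := ZLattice.module_finite ℝ Λ
  obtain ⟨Ψ, hΨ⟩ := exists_equiv_real_rational Λ ρ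
  let of := MonoidAlgebra.of ℚ G
  have hΨg : ∀ g z, Ψ (realSMul ρ.rational.asModule (of g) z) = lin g (Ψ z) := by
    intro g z
    have h : Ψ.toLinearMap ∘ₗ realSMul ρ.rational.asModule (of g) =
        (lin g).restrictScalars ℝ ∘ₗ Ψ.toLinearMap := by
      refine ρ.real_rational_ext fun l => ?_
      simp only [LinearMap.comp_apply, realSMul_tmul, LinearEquiv.coe_coe,
        LinearMap.coe_restrictScalars, hΨ, ← hρ, of, ← ρ.toRational_apply]
    exact LinearMap.congr_fun h z
  -- the complex structure of `ℂⁿ`, transported to the real scalar extension of `Λ`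
  have hcs : HasComplexStructure (MonoidAlgebra ℚ G) ρ.rational.asModule := by
    let J : ℝ ⊗[ℚ] ρ.rational.asModule →ₗ[ℝ] ℝ ⊗[ℚ] ρ.rational.asModule :=
      Ψ.symm.toLinearMap ∘ₗ (LinearMap.lsmul ℂ (CSpace n) Complex.I).restrictScalars ℝ ∘ₗ
        Ψ.toLinearMap
    have hJ : ∀ z, Ψ (J z) = Complex.I • Ψ z := fun z => Ψ.apply_symm_apply _
    refine ⟨J, isRealEquivariant_of_forall_of _ fun g z => Ψ.injective ?_,
      fun z => Ψ.injective ?_⟩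
    · rw [hJ, hΨg, hΨg, hJ, map_smul]
    · rw [hJ, hJ, smul_smul, Complex.I_mul_I, neg_one_smul, map_neg]
  obtain ⟨NQ, hNQ, hNQN⟩ := ρ.exists_submodule_rational N hN hpure
  obtain ⟨N', hN', ⟨J, hJ, hJ2⟩, hrank⟩ := hcs.exists_le_quotient NQ
  have finV : Module.Finite ℚ (ρ.rational.asModule ⧸ N') :=
    Module.Finite.of_surjective (N'.mkQ.restrictScalars ℚ) N'.mkQ_surjective
  let T : G →* Module.End ℝ (ℝ ⊗[ℚ] (ρ.rational.asModule ⧸ N')) :=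
    { toFun := fun g => realSMul _ (of g)
      map_one' := by
        refine LinearMap.ext fun w => ?_
        rw [map_one, realSMul_one_apply, Module.End.one_apply]
      map_mul' := fun g h => by
        refine LinearMap.ext fun w => ?_
        rw [map_mul, realSMul_mul_apply, Module.End.mul_apply] }
  obtain ⟨m, θ, lin', hm, hθ⟩ := exists_equiv_CSpace J hJ2 T fun g w => (hJ (of g) w).symm
  let π : CSpace n →ₗ[ℝ] CSpace m :=
    θ.toLinearMap ∘ₗ realExt N'.mkQ ∘ₗ Ψ.symm.toLinearMap
  have hπ : ∀ l : Λ, π l = θ (1 ⊗ₜ N'.mkQ (ρ.toRational l)) := by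
    intro l
    have : Ψ.symm (l : CSpace n) = 1 ⊗ₜ ρ.toRational l := by
      rw [← hΨ, Ψ.symm_apply_apply]
    simp only [π, LinearMap.comp_apply, LinearEquiv.coe_coe, this, realExt_tmul]
  have hspan : Submodule.span ℚ (Set.range ((N'.mkQ.restrictScalars ℤ) ∘ₗ ρ.toRational)) = ⊤ := by
    have h1 := congrArg (Submodule.map (N'.mkQ.restrictScalars ℚ)) ρ.span_range_toRational
    rw [Submodule.map_span, ← Set.range_comp, Submodule.map_top, LinearMap.range_eq_top.2
      (show Function.Surjective (N'.mkQ.restrictScalars ℚ) from N'.mkQ_surjective)] at h1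
    exact h1
  obtain ⟨Λ', hd, hz, hΛ'⟩ := exists_lattice_real_extension _ hspan θ
  refine ⟨m, π, lin', Λ', hd, hz, ?_, ?_, ?_, ?_⟩
  · rw [Module.finrank_baseChange] at hm
    omega
  · intro g z
    obtain ⟨y, rfl⟩ := Ψ.surjective z
    simp only [π, ← hΨg, LinearMap.comp_apply, LinearEquiv.coe_coe, LinearEquiv.symm_apply_apply,
      realExt_realSMul, ← hθ]
    rfl
  · intro l hl
    rw [hπ, map_eq_zero_iff _ θ.injective] at hl
    have h1 : N'.mkQ (ρ.toRational l) = 0 :=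
      Module.FaithfullyFlat.tensorProduct_mk_injective (A := ℚ) (B := ℝ) _
        (hl.trans (map_zero _).symm)
    exact hNQN l (hN' ((Submodule.Quotient.mk_eq_zero N').1 h1))
  · intro w
    rw [hΛ']
    constructor
    · rintro ⟨l, rfl⟩
      exact ⟨l, l.2, hπ l⟩
    · rintro ⟨l, hl, rfl⟩
      exact ⟨⟨l, hl⟩, (hπ ⟨l, hl⟩).symm⟩

end ComplexQuotient

/-! ### The maximal abelian normal subgroup -/

namespace ComplexCrystallographicAction

variable {Γ : Type*} [Group Γ] {n : ℕ} (S : ComplexCrystallographicAction Γ n)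

lemma trans_injective : Function.Injective S.trans := by
  intro γ δ h
  have h1 : δ⁻¹ * γ = 1 := by
    refine S.free _ 0 ?_
    rw [map_zero, zero_add, S.trans_mul, h]
    have := S.trans_mul δ⁻¹ δ
    rw [inv_mul_cancel, S.trans_one] at this
    exact this.symm
  exact (inv_mul_eq_one.1 h1).symm

lemma isMulCommutative_ker_lin : IsMulCommutative S.lin.ker := by
  refine ⟨⟨fun γ δ => Subtype.ext (S.trans_injective ?_)⟩⟩
  rw [Subgroup.coe_mul, Subgroup.coe_mul, S.trans_mul, S.trans_mul, γ.2, δ.2, add_comm]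
  rfl

lemma eq_one_of_forall_lattice {B : Module.End ℂ (CSpace n)} (h : ∀ l ∈ S.Λ, B l = l) :
    B = 1 := by
  have := S.discrete
  have h1 := S.isZLattice.span_top
  have h2 : B.restrictScalars ℝ = LinearMap.id := LinearMap.ext_on h1 fun l hl => h l hl
  ext1 z
  exact LinearMap.congr_fun h2 z

/-- Every abelian normal subgroup consists of translations: if `a` is in such a subgroup and has
linear part `B`, then `a` commutes with its commutators with translations, so that `(B - 1)² = 0`;
as `B` has finite order, this implies `B = 1`. -/
lemma le_ker_lin {A : Subgroup Γ} (hA : A.Normal) (hAc : IsMulCommutative A) :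
    A ≤ S.lin.ker := by
  intro a ha
  refine S.eq_one_of_forall_lattice fun l hl => ?_
  obtain ⟨k, hk, rfl⟩ := (S.mem_lattice_iff l).1 hl
  set l := S.trans k
  have hc : k * a * k⁻¹ * a⁻¹ ∈ A := A.mul_mem (hA.conj_mem a ha k) (A.inv_mem ha)
  obtain ⟨c, hcdef⟩ : ∃ c, c = k * a * k⁻¹ * a⁻¹ := ⟨_, rfl⟩
  rw [← hcdef] at hc
  have hlk := S.lin_eq_one k hk
  have hlc : S.lin c = 1 := by
    have h1 : S.lin k⁻¹ = 1 := S.lin_eq_one _ (S.K.inv_mem hk)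
    rw [hcdef, map_mul, map_mul, map_mul, hlk, h1, one_mul, mul_one, ← map_mul, mul_inv_cancel,
      map_one]
  have htc : S.trans c = l - S.lin a l := by
    have h1 : c * (a * k) = k * a := by rw [hcdef]; group
    have h2 := congrArg S.trans h1
    rw [S.trans_mul, S.trans_mul, S.trans_mul, hlc, hlk, Module.End.one_apply,
      Module.End.one_apply] at h2
    have h3 : S.trans c = l + S.trans a - (S.trans a + S.lin a l) := eq_sub_of_add_eq h2
    rw [h3]; abel
  have hcomm : a * c = c * a := by
    have := hAc.1.1 ⟨a, ha⟩ ⟨c, hc⟩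
    exact congrArg Subtype.val this
  have hfix : S.lin a (S.trans c) = S.trans c := by
    have h2 := congrArg S.trans hcomm
    rw [S.trans_mul, S.trans_mul, hlc, Module.End.one_apply, add_comm] at h2
    exact add_right_cancel h2
  have hpow : ∀ j : ℕ, (S.lin (a ^ j)) l = l - j • S.trans c := by
    intro j
    induction j with
    | zero => simp
    | succ j ih =>
      rw [pow_succ', map_mul, Module.End.mul_apply, ih, map_sub, map_nsmul, hfix, add_smul,
        one_smul]
      have : S.lin a l = l - S.trans c := by rw [htc]; abel
      rw [this]; abel
  have hfin := S.finiteIndex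
  have := S.normal
  have h1 := hpow S.K.index
  rw [S.lin_eq_one _ (S.K.pow_index_mem a), Module.End.one_apply] at h1
  have h2 : S.K.index • S.trans c = 0 := sub_eq_self.1 h1.symm
  have h3 : S.trans c = 0 := by
    rw [← Nat.cast_smul_eq_nsmul ℂ] at h2
    exact (smul_eq_zero.1 h2).resolve_left (Nat.cast_ne_zero.2 hfin.index_ne_zero)
  rw [h3] at htc
  exact (sub_eq_zero.1 htc.symm).symm

/-- The maximal abelian normal subgroup is the group of all translations. -/
lemma eq_ker_lin_of_isMaximalAbelianNormal {L : Subgroup Γ} (hL : IsMaximalAbelianNormal L) :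
    L = S.lin.ker :=
  le_antisymm (S.le_ker_lin hL.1.1 hL.1.2)
    (hL.2 ⟨inferInstance, S.isMulCommutative_ker_lin⟩ (S.le_ker_lin hL.1.1 hL.1.2))

lemma K_le_ker_lin : S.K ≤ S.lin.ker := fun γ hγ => S.lin_eq_one γ hγ

/-- The group of all translation vectors. -/
def translations : Submodule ℤ (CSpace n) where
  carrier := {l | ∃ γ ∈ S.lin.ker, S.trans γ = l}
  zero_mem' := ⟨1, S.lin.ker.one_mem, S.trans_one⟩
  add_mem' := by
    rintro _ _ ⟨γ, hγ, rfl⟩ ⟨δ, hδ, rfl⟩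
    refine ⟨γ * δ, S.lin.ker.mul_mem hγ hδ, ?_⟩
    rw [S.trans_mul, MonoidHom.mem_ker.1 hγ, Module.End.one_apply]
  smul_mem' := by
    rintro k _ ⟨γ, hγ, rfl⟩
    refine ⟨γ ^ k, S.lin.ker.zpow_mem hγ k, ?_⟩
    let t : S.lin.ker →* Multiplicative (CSpace n) :=
      { toFun := fun γ => Multiplicative.ofAdd (S.trans γ)
        map_one' := congrArg _ S.trans_one
        map_mul' := fun γ δ => by
          rw [Subgroup.coe_mul, S.trans_mul, MonoidHom.mem_ker.1 γ.2]
          rfl }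
    exact congrArg Multiplicative.toAdd (map_zpow t ⟨γ, hγ⟩ k)

lemma le_translations : S.Λ ≤ S.translations := by
  intro l hl
  obtain ⟨γ, hγ, rfl⟩ := (S.mem_lattice_iff l).1 hl
  exact ⟨γ, S.K_le_ker_lin hγ, rfl⟩

/-- A multiple of every translation vector lies in the lattice `Λ`, as `K` has finite index. -/
lemma index_nsmul_mem {l : CSpace n} (hl : l ∈ S.translations) : S.K.index • l ∈ S.Λ := by
  obtain ⟨γ, hγ, rfl⟩ := hl
  have := S.normal
  have hpow : ∀ j : ℕ, S.trans (γ ^ j) = j • S.trans γ := fun j => by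
    induction j with
    | zero => simpa using S.trans_one
    | succ j ih =>
      rw [pow_succ', S.trans_mul, MonoidHom.mem_ker.1 hγ, Module.End.one_apply, ih, succ_nsmul']
  rw [← hpow]
  exact (S.mem_lattice_iff _).2 ⟨_, S.K.pow_index_mem γ, rfl⟩

lemma discreteTopology_translations : DiscreteTopology S.translations := by
  have := S.discrete
  have hfin := S.finiteIndex
  have hd : (0 : ℝ) < S.K.index := Nat.cast_pos.2 (Nat.pos_of_ne_zero hfin.index_ne_zero)
  obtain ⟨r, hr, h⟩ := exists_pos_forall_norm_lt_eq_zero S.Λ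
  refine discreteTopology_of_forall_norm_lt_eq_zero (div_pos hr hd) fun l hl hlr => ?_
  have h1 := h _ (S.index_nsmul_mem hl) (by
    rw [← Nat.cast_smul_eq_nsmul ℝ, norm_smul, Real.norm_natCast, mul_comm]
    exact (lt_div_iff₀ hd).1 hlr)
  rw [← Nat.cast_smul_eq_nsmul ℝ] at h1
  exact (smul_eq_zero.1 h1).resolve_left hd.ne'

/-- The action with the subgroup `K` enlarged to the group of all translations. -/
def saturate : ComplexCrystallographicAction Γ n where
  lin := S.lin
  trans := S.trans
  trans_mul := S.trans_mul
  free := S.free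
  K := S.lin.ker
  normal := inferInstance
  finiteIndex := by
    have := S.finiteIndex
    exact Subgroup.finiteIndex_of_le S.K_le_ker_lin
  Λ := S.translations
  discrete := S.discreteTopology_translations
  isZLattice := by
    have := S.discrete
    have := S.discreteTopology_translations
    exact ⟨top_le_iff.1 (S.isZLattice.span_top.ge.trans (Submodule.span_mono S.le_translations))⟩
  lin_eq_one γ h := h
  mem_lattice_iff l := Iff.rfl

end ComplexCrystallographicAction

/-! ### The complex Vasquez problem -/

namespace ComplexCrystallographicAction

variable {Γ : Type} [Group Γ] {n : ℕ} (S : ComplexCrystallographicAction Γ n)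
  {G : Type} [Group G]

/-- An equivariant real-linear map `π` from `ℂⁿ` to a complex representation `ℂᵐ`, which maps the
lattice of `S` onto a full lattice, induces a crystallographic action on `ℂᵐ` of the quotient of `Γ`
by the translations in the kernel of `π`, provided that this action is free. -/
theorem exists_quotient_action (p : Γ →* G) (hK : S.K = p.ker) {m : ℕ}
    (π : CSpace n →ₗ[ℝ] CSpace m) (lin' : G →* Module.End ℂ (CSpace m))
    (hπ : ∀ γ z, π (S.lin γ z) = lin' (p γ) (π z))
    (Λ' : Submodule ℤ (CSpace m)) (hd : DiscreteTopology Λ') (hz : IsZLattice ℝ Λ')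
    (hΛ' : ∀ w, w ∈ Λ' ↔ ∃ l ∈ S.Λ, π l = w)
    (hfree : ∀ γ z, lin' (p γ) z + π (S.trans γ) = z → p γ = 1) :
    ∃ (M : Subgroup Γ) (_ : M.Normal), M ≤ p.ker ∧
      Nonempty (ComplexCrystallographicAction (Γ ⧸ M) m) := by
  have hmul : ∀ γ δ, π (S.trans (γ * δ)) = π (S.trans γ) + lin' (p γ) (π (S.trans δ)) := by
    intro γ δ
    rw [S.trans_mul, map_add, hπ]
  let M : Subgroup Γ :=
    { carrier := {γ | γ ∈ p.ker ∧ π (S.trans γ) = 0}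
      one_mem' := ⟨p.ker.one_mem, by rw [S.trans_one, map_zero]⟩
      mul_mem' := by
        rintro γ δ ⟨h1, h2⟩ ⟨h3, h4⟩
        exact ⟨p.ker.mul_mem h1 h3, by rw [hmul, h2, h4, map_zero, add_zero]⟩
      inv_mem' := by
        rintro γ ⟨h1, h2⟩
        refine ⟨p.ker.inv_mem h1, ?_⟩
        have h3 := hmul γ⁻¹ γ
        rw [inv_mul_cancel, S.trans_one, map_zero, h2, map_zero, add_zero] at h3
        exact h3.symm }
  have hM : ∀ γ, γ ∈ M ↔ p γ = 1 ∧ π (S.trans γ) = 0 := fun γ => Iff.rfl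
  have hMn : M.Normal := by
    refine ⟨fun δ hδ γ => ?_⟩
    obtain ⟨h1, h2⟩ := (hM δ).1 hδ
    refine (hM _).2 ⟨by rw [map_mul, map_mul, h1, mul_one, ← map_mul, mul_inv_cancel, map_one], ?_⟩
    rw [hmul, hmul, h2, map_zero, add_zero, map_mul, h1, mul_one, ← hmul, mul_inv_cancel,
      S.trans_one, map_zero]
  let t : Γ ⧸ M → CSpace m := Quotient.lift (fun γ => π (S.trans γ)) (by
    intro γ δ h
    obtain ⟨h1, h2⟩ := (hM _).1 (QuotientGroup.leftRel_apply.1 h)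
    have h3 := hmul γ (γ⁻¹ * δ)
    rw [mul_inv_cancel_left, h2, map_zero, add_zero] at h3
    exact h3.symm)
  have ht : ∀ γ : Γ, t γ = π (S.trans γ) := fun γ => rfl
  let L : Γ ⧸ M →* Module.End ℂ (CSpace m) := QuotientGroup.lift M (lin'.comp p) (fun γ hγ => by
    rw [MonoidHom.mem_ker, MonoidHom.comp_apply, ((hM γ).1 hγ).1, map_one])
  have hL : ∀ γ : Γ, L γ = lin' (p γ) := fun γ => rfl
  refine ⟨M, hMn, fun γ hγ => hγ.1, ⟨{
    lin := L
    trans := t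
    trans_mul := fun a b => by
      obtain ⟨γ, rfl⟩ := QuotientGroup.mk_surjective a
      obtain ⟨δ, rfl⟩ := QuotientGroup.mk_surjective b
      rw [← QuotientGroup.mk_mul, ht, ht, ht, hL, hmul]
    free := fun a z h => by
      obtain ⟨γ, rfl⟩ := QuotientGroup.mk_surjective a
      rw [ht, hL] at h
      have h1 := hfree γ z h
      rw [h1, map_one, Module.End.one_apply, add_eq_left] at h
      exact (QuotientGroup.eq_one_iff γ).2 ⟨h1, h⟩
    K := p.ker.map (QuotientGroup.mk' M)
    normal := inferInstance
    finiteIndex := by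
      have := hK ▸ S.finiteIndex
      exact ⟨ne_zero_of_dvd_ne_zero this.index_ne_zero
        (Subgroup.index_map_dvd _ (QuotientGroup.mk'_surjective M))⟩
    Λ := Λ'
    discrete := hd
    isZLattice := hz
    lin_eq_one := by
      rintro _ ⟨γ, hγ, rfl⟩
      exact (hL γ).trans (by rw [MonoidHom.mem_ker.1 hγ, map_one])
    mem_lattice_iff := fun w => by
      rw [hΛ']
      constructor
      · rintro ⟨l, hl, rfl⟩
        obtain ⟨γ, hγ, rfl⟩ := (S.mem_lattice_iff l).1 hl
        rw [hK] at hγ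
        exact ⟨γ, ⟨γ, hγ, rfl⟩, ht γ⟩
      · rintro ⟨_, ⟨γ, hγ, rfl⟩, h⟩
        refine ⟨S.trans γ, (S.mem_lattice_iff _).2 ⟨γ, hK ▸ hγ, rfl⟩, h⟩ }⟩⟩

/-- The extension class of `Γ` does not vanish on any nontrivial subgroup `H` of `G`: if the cocycle
of a set-theoretic section `s` is the coboundary of `τ` on `H`, then `g ↦ trans (s g) - τ g` is a
cocycle with values in `ℂⁿ`, and averaging it over `H` produces a common fixed point of lifts of all
elements of `H`. -/
lemma eq_bot_of_coboundary [Finite G] (p : Γ →* G) (hK : S.K = p.ker)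
    (linG : G →* Module.End ℂ (CSpace n)) (hlin : ∀ γ, linG (p γ) = S.lin γ)
    (s : G → Γ) (hs : ∀ g, p (s g) = g) (H : Subgroup G) (τ : H → S.Λ)
    (hτ : ∀ g h : H, S.trans (s g) + linG g (S.trans (s h)) - S.trans (s (g * h)) =
      linG g (τ h) - τ (g * h) + τ g) : H = ⊥ := by
  have := Fintype.ofFinite H
  rw [Subgroup.eq_bot_iff_forall]
  intro h hh
  let v : H → CSpace n := fun g => S.trans (s g) - τ g
  have hv : ∀ g g' : H, v (g * g') = v g + linG g (v g') := by
    intro g g'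
    have h1 := hτ g g'
    simp only [v, map_sub, Subgroup.coe_mul]
    rw [← sub_eq_zero] at h1 ⊢
    rw [← neg_eq_zero, ← h1]
    abel
  have hcard : (Fintype.card H : ℂ) ≠ 0 := Nat.cast_ne_zero.2 Fintype.card_ne_zero
  let z : CSpace n := (Fintype.card H : ℂ)⁻¹ • ∑ g, v g
  have hz : ∀ g : H, linG g z + v g = z := by
    intro g
    have h1 : ∑ g', v g' = ∑ g', v (g * g') := (Equiv.sum_comp (Equiv.mulLeft g) v).symm
    simp only [hv, Finset.sum_add_distrib, Finset.sum_const, Finset.card_univ] at h1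
    have h2 : v g = (Fintype.card H : ℂ)⁻¹ • (Fintype.card H • v g) := by
      rw [← Nat.cast_smul_eq_nsmul ℂ, smul_smul, inv_mul_cancel₀ hcard, one_smul]
    rw [h2, map_smul, ← smul_add, map_sum, add_comm, ← h1]
  obtain ⟨k, hk, hkt⟩ := (S.mem_lattice_iff _).1 (S.Λ.neg_mem (τ ⟨h, hh⟩).2)
  have hpk : p k = 1 := by
    rw [hK] at hk
    exact hk
  have hk1 : k * s h = 1 := by
    refine S.free _ z ?_
    rw [S.trans_mul, map_mul, S.lin_eq_one k hk, one_mul, Module.End.one_apply, hkt, ← hlin, hs]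
    rw [neg_add_eq_sub]
    exact hz ⟨h, hh⟩
  have h3 := congrArg p hk1
  rwa [map_mul, hpk, hs, one_mul, map_one] at h3

lemma lin_eq_of_eq (p : Γ →* G) (hK : S.K = p.ker) {γ δ : Γ} (h : p γ = p δ) :
    S.lin γ = S.lin δ := by
  have h1 : S.lin (γ * δ⁻¹) = 1 := S.lin_eq_one _ (by
    rw [hK, MonoidHom.mem_ker, map_mul, h, ← map_mul, mul_inv_cancel, map_one])
  rw [map_mul] at h1
  rw [← mul_one (S.lin γ), ← map_one S.lin, ← inv_mul_cancel δ, map_mul, ← mul_assoc, h1, one_mul]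

lemma trans_sub_trans_mem (p : Γ →* G) (hK : S.K = p.ker) {γ δ : Γ} (h : p γ = p δ) :
    S.trans γ - S.trans δ ∈ S.Λ := by
  refine (S.mem_lattice_iff _).2 ⟨γ * δ⁻¹, ?_, ?_⟩
  · rw [hK, MonoidHom.mem_ker, map_mul, h, ← map_mul, mul_inv_cancel, map_one]
  · rw [S.trans_mul, S.lin_eq_of_eq p hK h, S.trans_inv, sub_eq_add_neg]

/-- The holonomy representation: the linear parts, as a representation of the quotient `G` of `Γ`
by the group of translations `K`. -/
lemma exists_holonomy (p : Γ →* G) (hp : Function.Surjective p) (hK : S.K = p.ker) :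
    ∃ linG : G →* Module.End ℂ (CSpace n), ∀ γ, linG (p γ) = S.lin γ := by
  obtain ⟨s, hs⟩ := hp.hasRightInverse
  refine ⟨{ toFun := fun g => S.lin (s g), map_one' := ?_, map_mul' := fun g h => ?_ },
    fun γ => S.lin_eq_of_eq p hK (hs (p γ))⟩
  · rw [← map_one S.lin]
    exact S.lin_eq_of_eq p hK (by rw [hs, map_one])
  · rw [← map_mul]
    exact S.lin_eq_of_eq p hK (by rw [hs, map_mul, hs, hs])

/-- Let `π` be an equivariant map from `ℂⁿ` to another representation `ℂᵐ`. If an element `γ` of `Γ`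
has a fixed point in the induced affine action on `ℂᵐ`, then modulo the kernel of `π` the extension
class of `Γ` becomes a coboundary on the group generated by the image of `γ` in `G`: the powers of
`γ` provide lifts with a common fixed point, hence a splitting. -/
lemma exists_coboundary_of_fixedPoint (p : Γ →* G) (hK : S.K = p.ker)
    (linG : G →* Module.End ℂ (CSpace n)) (hlin : ∀ γ, linG (p γ) = S.lin γ)
    (s : G → Γ) (hs : ∀ g, p (s g) = g) {m : ℕ}
    (π : CSpace n →ₗ[ℝ] CSpace m) (lin' : G →* Module.End ℂ (CSpace m))
    (hπ : ∀ g z, π (linG g z) = lin' g (π z)) {γ : Γ} {z : CSpace m}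
    (hγ : lin' (p γ) z + π (S.trans γ) = z) :
    ∃ a : Subgroup.zpowers (p γ) → S.Λ, ∀ g h : Subgroup.zpowers (p γ),
      π ((S.trans (s g) + linG g (S.trans (s h)) - S.trans (s (g * h))) -
        (linG g (a h) - a (g * h) + a g)) = 0 := by
  have hmul : ∀ γ δ, π (S.trans (γ * δ)) = π (S.trans γ) + lin' (p γ) (π (S.trans δ)) := by
    intro γ δ
    rw [S.trans_mul, map_add, ← hlin, hπ]
  let Fix : Subgroup Γ :=
    { carrier := {γ | π (S.trans γ) = z - lin' (p γ) z}
      one_mem' := by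
        change π (S.trans 1) = z - lin' (p 1) z
        rw [S.trans_one, map_zero, map_one, map_one, Module.End.one_apply, sub_self]
      mul_mem' := by
        intro γ δ (h1 : π (S.trans γ) = z - lin' (p γ) z)
          (h2 : π (S.trans δ) = z - lin' (p δ) z)
        change π (S.trans (γ * δ)) = z - lin' (p (γ * δ)) z
        rw [hmul, h1, h2, map_mul, map_mul, Module.End.mul_apply, map_sub]
        abel
      inv_mem' := by
        intro γ (h1 : π (S.trans γ) = z - lin' (p γ) z)
        change π (S.trans γ⁻¹) = z - lin' (p γ⁻¹) z
        have h2 := hmul γ⁻¹ γ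
        rw [inv_mul_cancel, S.trans_one, map_zero, h1, map_sub, ← Module.End.mul_apply,
          ← map_mul, ← map_mul, inv_mul_cancel, map_one, map_one, Module.End.one_apply] at h2
        rw [eq_neg_of_add_eq_zero_left h2.symm, neg_sub] }
  have hγF : γ ∈ Fix := (eq_sub_of_add_eq' hγ : π (S.trans γ) = z - lin' (p γ) z)
  -- lifts to `Γ` with a common fixed point, for all elements of the group generated by `p γ`
  have hδ : ∀ x : Subgroup.zpowers (p γ), ∃ δ ∈ Fix, p δ = x := by
    rintro ⟨_, i, rfl⟩
    exact ⟨γ ^ i, Fix.zpow_mem hγF i, map_zpow p γ i⟩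
  choose δ hδF hpδ using hδ
  have hδF' : ∀ x, π (S.trans (δ x)) = z - lin' x z := fun x => by
    rw [← hpδ]
    exact hδF x
  let a : Subgroup.zpowers (p γ) → S.Λ := fun x =>
    ⟨S.trans (s x) - S.trans (δ x), S.trans_sub_trans_mem p hK (by rw [hs, hpδ])⟩
  refine ⟨a, fun g h => ?_⟩
  simp only [a, map_sub, map_add, hπ, hδF', Subgroup.coe_mul, map_mul, Module.End.mul_apply]
  abel

end ComplexCrystallographicAction

/-- A bound in the Vasquez problem bounds the complex dimension too. The pure subgroup `N` obtained
for the group of translations contains the kernel of a map onto a lattice in some `ℂᵐ`, with `m` at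
most the rank of the quotient by `N`; as the extension class is special modulo `N`, the induced
affine action on `ℂᵐ` is free. -/
theorem IsVasquezBound.isComplexVasquezBound {G : Type} [Group G] [Finite G] {k : ℕ}
    (hk : IsVasquezBound G k) : IsComplexVasquezBound G k := by
  intro Γ _ n hΓ p hp hmax
  obtain ⟨S₀⟩ := hΓ.nonempty_action
  have hker : p.ker = S₀.lin.ker := S₀.eq_ker_lin_of_isMaximalAbelianNormal hmax
  obtain ⟨S, hK, hKlin⟩ : ∃ S : ComplexCrystallographicAction Γ n, S.K = p.ker ∧
      S.K = S.lin.ker := ⟨S₀.saturate, hker.symm, rfl⟩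
  have := S.discrete
  have := S.isZLattice
  have : Module.Free ℤ S.Λ := ZLattice.module_free ℝ S.Λ
  have : Module.Finite ℤ S.Λ := ZLattice.module_finite ℝ S.Λ
  obtain ⟨s, hs⟩ : ∃ s : G → Γ, ∀ g, p (s g) = g := hp.hasRightInverse
  obtain ⟨linG, hlin⟩ := S.exists_holonomy p hp hK
  have hmem : ∀ g, ∀ l ∈ S.Λ, linG g l ∈ S.Λ := by
    intro g l hl
    rw [← hs g, hlin]
    exact S.lin_mem hl _
  let ρ : Representation ℤ G S.Λ :=
    { toFun := fun g => ((linG g).restrictScalars ℤ).restrict (hmem g)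
      map_one' := by
        ext1 l
        apply Subtype.ext
        change linG 1 l = l
        rw [map_one, Module.End.one_apply]
      map_mul' := fun g h => by
        ext1 l
        apply Subtype.ext
        change linG (g * h) l = linG g (linG h l)
        rw [map_mul, Module.End.mul_apply] }
  have hρ : ∀ g (l : S.Λ), (ρ g l : CSpace n) = linG g l := fun g l => rfl
  have hinj : Function.Injective ρ := by
    rw [injective_iff_map_eq_one]
    intro g hg
    have h1 : linG g = 1 := S.eq_one_of_forall_lattice fun l hl => by
      rw [← hρ g ⟨l, hl⟩, hg]
      rfl
    rw [← hs g, hlin] at h1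
    rw [← hs g]
    refine MonoidHom.mem_ker.1 ?_
    rw [← hK, hKlin]
    exact h1
  -- the cocycle of the extension, for the section `s`
  have hσmem : ∀ g h : G,
      S.trans (s g) + linG g (S.trans (s h)) - S.trans (s (g * h)) ∈ S.Λ := by
    intro g h
    have h1 := S.trans_sub_trans_mem p hK (γ := s g * s h) (δ := s (g * h))
      (by rw [map_mul, hs, hs, hs])
    rwa [S.trans_mul, ← hlin, hs] at h1
  let σ₀ : G × G → S.Λ := fun x => ⟨_, hσmem x.1 x.2⟩
  have hσ₀ : σ₀ ∈ groupCohomology.cocycles₂ (Rep.of ρ) := by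
    refine (groupCohomology.mem_cocycles₂_iff (A := Rep.of ρ) σ₀).2 fun g h j => Subtype.ext ?_
    change (S.trans (s (g * h)) + linG (g * h) (S.trans (s j)) - S.trans (s (g * h * j))) +
      (S.trans (s g) + linG g (S.trans (s h)) - S.trans (s (g * h))) =
      linG g (S.trans (s h) + linG h (S.trans (s j)) - S.trans (s (h * j))) +
      (S.trans (s g) + linG g (S.trans (s (h * j))) - S.trans (s (g * (h * j))))
    rw [map_mul, Module.End.mul_apply, map_sub, map_add, mul_assoc]
    abel
  let σ : groupCohomology.cocycles₂ (Rep.of ρ) := ⟨σ₀, hσ₀⟩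
  have hspecial : IsSpecialClass (groupCohomology.H2π (Rep.of ρ) σ) := by
    rw [isSpecialClass_H2π_iff]
    rintro H hH ⟨τ, hτ⟩
    exact hH (S.eq_bot_of_coboundary p hK linG hlin s hs H τ fun g h =>
      congrArg Subtype.val (hτ g h))
  obtain ⟨N, hN, hpure, hrank, hNspecial⟩ := hk S.Λ ρ hinj _ hspecial
  rw [isSpecialClass_map_mkQ_iff] at hNspecial
  obtain ⟨m, π, lin', Λ', hd, hz, hm, hπ, hπN, hΛ'⟩ :=
    exists_complex_quotient S.Λ linG ρ hρ N hN hpure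
  have hfree : ∀ γ z, lin' (p γ) z + π (S.trans γ) = z → p γ = 1 := by
    intro γ z hγ
    by_contra hne
    obtain ⟨a, ha⟩ := S.exists_coboundary_of_fixedPoint p hK linG hlin s hs π lin' hπ hγ
    refine hNspecial (Subgroup.zpowers (p γ)) (by simpa using hne)
      ⟨fun x => N.mkQ (a x), fun g h => ?_⟩
    change N.mkQ (σ₀ (g, h)) = N.mkQ (ρ g (a h)) - N.mkQ (a (g * h)) + N.mkQ (a g)
    rw [← map_sub, ← map_add]
    exact (Submodule.Quotient.eq N).2 (hπN _ (ha g h))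
  obtain ⟨M, hM, hMp, ⟨S'⟩⟩ := S.exists_quotient_action p hK π lin'
    (fun γ z => by rw [← hlin, hπ]) Λ' hd hz hΛ' hfree
  exact ⟨M, hM, hMp, m, hm.trans hrank, S'.isAsphericalKahlerGroup⟩

end

theorem mainTheorem1 (G : Type) [Group G] [Finite G] :
    ∃ nC n : ℕ,
      IsLeast {k : ℕ | IsComplexVasquezBound G k} nC ∧
      IsLeast {k : ℕ | IsVasquezBound G k} n ∧
      nC ≤ n := by
  classical
  have hn : ∃ k, IsVasquezBound G k := ⟨_, isVasquezBound_card_sq G⟩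
  have hC : IsComplexVasquezBound G (Nat.find hn) := (Nat.find_spec hn).isComplexVasquezBound
  exact ⟨Nat.find ⟨_, hC⟩, Nat.find hn, ⟨Nat.find_spec ⟨_, hC⟩, fun _ h => Nat.find_min' _ h⟩,
    ⟨Nat.find_spec hn, fun _ h => Nat.find_min' _ h⟩, Nat.find_min' _ hC⟩
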